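/- Let $n\ge 1$, let $$B_{n+1}=\langle a_1,\dots,a_n \mid a_{i+1}a_ia_{i+1}=a_ia_{i+1}a_i\ (1\le i\le n-1),\ a_sa_k=a_ka_s\ (s-k\ge 2)\rangle$$ be the braid group and $B_{n+1}^+$ the monoid with the same presentation. Put $a_{ij}=a_ia_{i-1}\cdots a_j$ for $j\le i$, $a_{i,i+1}=1$, $\Lambda_i=a_{i1}$ and $\Delta=\Lambda_1\Lambda_2\cdots\Lambda_n$. Let $V(j,i)$ denote an arbitrary positive word in $a_j,\dots,a_i$ (the empty word if $j=i+1$), and let $V^{(k)}$ be $V$ with all indices raised by $k$, $V'=V^{(1)}$. Words in the alphabet $\Delta^{-1}<\Delta<a_1<\dots<a_n$, and positive words (words in $a_1,\dots,a_n$), are ordered degree-lexicographically. Let $S$ be the set of the relations 1. $a_{i+1}a_i\,V\,W\,a_{i+1,j}=a_ia_{i+1}a_i\,V\,a_{ij}\,W'$ for $1\le i\le n-1$, $1\le j\le i+1$, $V=V(1,i-1)$, and $W=W(j,i)$ either empty or beginning with $a_i$; 2. $a_sa_k=a_ka_s$ for $s-k\ge 2$; 3. $\Lambda_1V_1\Lambda_2V_2\cdots\Lambda_{n-1}V_{n-1}\Lambda_n=\Delta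 V_1^{(n-1)}V_2^{(n-2)}\cdots V_{n-1}'$ for $V_i=V_i(1,i)$; 4. $a_l\Delta=\Delta a_{n-l+1}$ and $a_l\Delta^{-1}=\Delta^{-1}a_{n-l+1}$ for $1\le l\le n$; 5. $\Delta\Delta^{-1}=1$ and $\Delta^{-1}\Delta=1$; in each of which the left-hand side is the leading word. A word is $S$-irreducible if it contains no left-hand side of a relation of $S$ as a (contiguous) subword. The $S$-irreducible normal form of $g\in B_{n+1}$ is the $S$-irreducible word in the above alphabet that represents $g$. The Garside normal form of $g$ is the expression $\Delta^kA$ with $g=\Delta^kA$ in $B_{n+1}$, where $k\in\mathbb Z$ and $A$ is a positive word such that $A\ne\Delta A_1$ in $B_{n+1}^+$ for every positive word $A_1$, and $A$ is the smallest word with these properties. **Corollary.** Every $g\in B_{n+1}$ has exactly one $S$-irreducible normal form and exactly one Garside normal form. The former is the word $\Delta^kA$ with $k\in\mathbb Z$ and $A$ a positive word such that $A\neq\Delta A_1$ in $B_{n+1}$ for every positive word $A_1$, and the latter is given by the same $k$ and the same word $A$. This gives an algorithm for the Garside normal form: starting with any word in $\Delta^{-1},\Delta,a_1,\dots,a_n$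 that represents $g$, replace subwords that are left-hand sides of relations of $S$ by the corresponding right-hand sides. In whatever order this is done, the process terminates, and it can stop only at the word $\Delta^kA$. In particular, the explicit procedure that lists all eliminations possible in the current word (by position and length of the subword, then by relation), and performs the first one until there is none left, stops at $\Delta^kA$ after finitely many steps. -/

import Mathlib

namespace ArtinGarside

/-! ### Braid group and braid monoid

The Artin generators `a_1, …, a_n` are indexed by `Fin n`; the element `x : Fin n` stands for the
generator whose usual (1-based) index is `x + 1`. -/

/-- Positive words: words in `a_1, …, a_n`. -/
abbrev PosWord (n : ℕ) : Type := List (Fin n)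

/-- Artin's relations: `a_{i+1} a_i a_{i+1} = a_i a_{i+1} a_i`, and `a_s a_k = a_k a_s` for
`s - k > 1`. -/
inductive ArtinRel (n : ℕ) : FreeMonoid (Fin n) → FreeMonoid (Fin n) → Prop
  | braid (i j : Fin n) (h : j.val = i.val + 1) :
      ArtinRel n (FreeMonoid.of j * FreeMonoid.of i * FreeMonoid.of j)
        (FreeMonoid.of i * FreeMonoid.of j * FreeMonoid.of i)
  | comm (k s : Fin n) (h : k.val + 2 ≤ s.val) :
      ArtinRel n (FreeMonoid.of s * FreeMonoid.of k) (FreeMonoid.of k * FreeMonoid.of s)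

/-- The braid monoid `B_{n+1}^+`. -/
abbrev BraidMonoid (n : ℕ) : Type := PresentedMonoid (ArtinRel n)

/-- Artin's relations as relators in the free group. -/
def artinRelators (n : ℕ) : Set (FreeGroup (Fin n)) :=
  {r | ∃ u v : FreeMonoid (Fin n), ArtinRel n u v ∧
    r = FreeMonoid.lift FreeGroup.of u * (FreeMonoid.lift FreeGroup.of v)⁻¹}

/-- The braid group `B_{n+1}` on `n + 1` strands. -/
abbrev BraidGroup (n : ℕ) : Type := PresentedGroup (artinRelators n)

/-- The element of `B_{n+1}^+` represented by a positive word. -/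
def monoidVal {n : ℕ} (A : PosWord n) : BraidMonoid n :=
  (A.map (PresentedMonoid.of (ArtinRel n))).prod

/-- The element of `B_{n+1}` represented by a positive word. -/
def groupVal {n : ℕ} (A : PosWord n) : BraidGroup n :=
  (A.map (PresentedGroup.of (rels := artinRelators n))).prod

/-! ### Notation for positive words (all indices below are the 1-based ones) -/

/-- `a_{ij} = a_i a_{i-1} ⋯ a_j`, which is empty if `i < j`. -/
def desc (n i j : ℕ) : PosWord n :=
  ((List.finRange n).filter fun x => j ≤ x.val + 1 ∧ x.val + 1 ≤ i).reverse

/-- `Λ_i = a_i ⋯ a_1`. -/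
def lambdaWord (n i : ℕ) : PosWord n := desc n i 1

/-- The word `Λ_1 Λ_2 ⋯ Λ_n`. -/
def deltaWord (n : ℕ) : PosWord n := (List.range' 1 n).flatMap (lambdaWord n)

/-- `V = V(j,i)`: all letters of `V` are among `a_j, …, a_i`. -/
def InLetters {n : ℕ} (j i : ℕ) (V : PosWord n) : Prop :=
  ∀ x ∈ V, j ≤ x.val + 1 ∧ x.val + 1 ≤ i

instance {n : ℕ} (j i : ℕ) (V : PosWord n) : Decidable (InLetters j i V) := by
  unfold InLetters; infer_instance

/-- `W` is empty or begins with `a_i`. -/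
def StartsWith {n : ℕ} (i : ℕ) (W : PosWord n) : Prop := ∀ x ∈ W.head?, x.val + 1 = i

instance {n : ℕ} (i : ℕ) (W : PosWord n) : Decidable (StartsWith i W) := by
  unfold StartsWith; infer_instance

/-- `V^{(k)}`: all indices are raised by `k`. It is only used for words whose letters have indices
at most `n - k`, so that the reduction modulo `n` never takes effect. -/
def shift {n : ℕ} (k : ℕ) (V : PosWord n) : PosWord n :=
  V.map fun x => ⟨(x.val + k) % n, Nat.mod_lt _ x.pos⟩

/-! ### Words in the Artin–Garside generators and the rewriting system -/

/-- The alphabet `Δ⁻¹, Δ, a_1, …, a_n`. -/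
inductive Letter (n : ℕ) : Type
  | deltaInv : Letter n
  | delta : Letter n
  | a (x : Fin n) : Letter n
  deriving DecidableEq

/-- Words in `Δ⁻¹, Δ, a_1, …, a_n`. -/
abbrev Word (n : ℕ) : Type := List (Letter n)

/-- The element of `B_{n+1}` represented by a letter; `Δ` stands for `Λ_1 Λ_2 ⋯ Λ_n`. -/
def letterVal {n : ℕ} : Letter n → BraidGroup n
  | .deltaInv => (groupVal (deltaWord n))⁻¹
  | .delta => groupVal (deltaWord n)
  | .a x => PresentedGroup.of x

/-- The element of `B_{n+1}` represented by a word. -/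
def wordVal {n : ℕ} (w : Word n) : BraidGroup n := (w.map letterVal).prod

/-- A positive word as a word in the Artin–Garside generators. -/
def pos {n : ℕ} (A : PosWord n) : Word n := A.map Letter.a

/-- The word `Δ^k`, `k ∈ ℤ`: a power of the letter `Δ` or of the letter `Δ⁻¹`. -/
def deltaPow (n : ℕ) : ℤ → Word n
  | .ofNat k => List.replicate k Letter.delta
  | .negSucc k => List.replicate (k + 1) Letter.deltaInv

/-- `a_{i+1} a_i V W a_{i+1,j}`. -/
def leftBraid (n i j : ℕ) (V W : PosWord n) : Word n :=
  pos (desc n (i + 1) i ++ V ++ W ++ desc n (i + 1) j)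

/-- `a_i a_{i+1} a_i V a_{ij} W'`. -/
def rightBraid (n i j : ℕ) (V W : PosWord n) : Word n :=
  pos (desc n i i ++ desc n (i + 1) i ++ V ++ desc n i j ++ shift 1 W)

/-- `Λ_1 V_1 Λ_2 V_2 ⋯ Λ_{n-1} V_{n-1} Λ_n`. -/
def leftDelta (n : ℕ) (V : ℕ → PosWord n) : Word n :=
  pos ((List.range' 1 (n - 1)).flatMap (fun i => lambdaWord n i ++ V i) ++ lambdaWord n n)

/-- `Δ V_1^{(n-1)} V_2^{(n-2)} ⋯ V_{n-1}'`. -/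
def rightDelta (n : ℕ) (V : ℕ → PosWord n) : Word n :=
  Letter.delta :: pos ((List.range' 1 (n - 1)).flatMap fun i => shift (n - i) (V i))

/-- The set `S` of relations `u = v`; in each of them the left-hand side `u` is the leading word for
the degree-lexicographic order with `Δ⁻¹ < Δ < a_1 < ⋯ < a_n`. -/
inductive S (n : ℕ) : Word n → Word n → Prop
  | braid (i j : ℕ) (V W : PosWord n) (hi : 1 ≤ i) (hin : i + 1 ≤ n) (hj : 1 ≤ j)
      (hji : j ≤ i + 1) (hV : InLetters 1 (i - 1) V) (hW : InLetters j i W)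
      (hWi : StartsWith i W) : S n (leftBraid n i j V W) (rightBraid n i j V W)
  | comm (s k : Fin n) (h : k.val + 2 ≤ s.val) :
      S n [Letter.a s, Letter.a k] [Letter.a k, Letter.a s]
  | garside (V : ℕ → PosWord n) (hV : ∀ i, 1 ≤ i → i ≤ n - 1 → InLetters 1 i (V i)) :
      S n (leftDelta n V) (rightDelta n V)
  | conj (l : Fin n) : S n [Letter.a l, Letter.delta] [Letter.delta, Letter.a l.rev]
  | conjInv (l : Fin n) : S n [Letter.a l, Letter.deltaInv] [Letter.deltaInv, Letter.a l.rev]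
  | cancel : S n [Letter.delta, Letter.deltaInv] []
  | cancelInv : S n [Letter.deltaInv, Letter.delta] []

/-- A word is `S`-irreducible if no leading word of a relation of `S` is a subword of it. -/
def SIrreducible {n : ℕ} (w : Word n) : Prop :=
  ∀ p u v q : Word n, S n u v → w ≠ p ++ u ++ q

/-- `c` is an `S`-irreducible normal form of the braid `g`. -/
def IsSNormalForm {n : ℕ} (g : BraidGroup n) (c : Word n) : Prop :=
  wordVal c = g ∧ SIrreducible c

/-- Elimination of the leading word of a relation of `S` in a word. -/
inductive Reduces {n : ℕ} : Word n → Word n → Prop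
  | intro (p u v q : Word n) (h : S n u v) : Reduces (p ++ u ++ q) (p ++ v ++ q)

/-! ### Garside normal form -/

/-- `A` is not of the form `Δ A_1` in the braid monoid, for any positive word `A_1`. -/
def PrimeToDelta {n : ℕ} (A : PosWord n) : Prop :=
  ∀ A₁ : PosWord n, monoidVal A ≠ monoidVal (deltaWord n ++ A₁)

/-- `g = Δ^k A` in the braid group, where the positive word `A` is prime to `Δ`. -/
def IsDeltaForm {n : ℕ} (g : BraidGroup n) (k : ℤ) (A : PosWord n) : Prop :=
  g = groupVal (deltaWord n) ^ k * groupVal A ∧ PrimeToDelta A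

/-- `Δ^k A` is the Garside normal form of `g`: it is equal to `g`, the positive word `A` is prime to
`Δ`, and `A` is minimal with these properties in the degree-lexicographic order of positive words
with `a_1 < ⋯ < a_n`. -/
def IsGarsideNormalForm {n : ℕ} (g : BraidGroup n) (k : ℤ) (A : PosWord n) : Prop :=
  IsDeltaForm g k A ∧ ∀ (k' : ℤ) (A' : PosWord n), IsDeltaForm g k' A' →
    A = A' ∨ List.Shortlex (· < ·) A A'

/-! ### The algorithm

An explicit procedure that searches a word for a leading word of a relation of `S` and
eliminates it. -/

/-- The sequence of the letters `a_i` of a word. -/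
def posPart {n : ℕ} (w : Word n) : PosWord n :=
  w.filterMap fun
    | .a x => some x
    | _ => none

/-- What remains of `p` when `Λ_1 V_1 ⋯ Λ_i V_i` is read off from the left, with each `V_m` the
longest possible word in `a_1, …, a_m`. -/
def afterBlocks {n : ℕ} (p : PosWord n) : ℕ → PosWord n
  | 0 => p
  | i + 1 => ((afterBlocks p i).drop (i + 1)).dropWhile fun x => x.val + 1 ≤ i + 1

/-- The word `V_i` that is found in this way, for `i ≥ 1`. -/
def block {n : ℕ} (p : PosWord n) (i : ℕ) : PosWord n :=
  ((afterBlocks p (i - 1)).drop i).takeWhile fun x => x.val + 1 ≤ i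

/-- The list of the right-hand sides of the relations of `S` with left-hand side `u`. -/
def rightSides {n : ℕ} (u : Word n) : List (Word n) :=
  ((List.range' 1 (n - 1)).flatMap fun i => (List.range' 1 (i + 1)).flatMap fun j =>
    (List.range (u.length + 1)).flatMap fun b => (List.range (u.length + 1)).flatMap fun c =>
      let V := ((posPart u).drop 2).take b
      let W := ((posPart u).drop (2 + b)).take c
      if u = leftBraid n i j V W ∧ InLetters 1 (i - 1) V ∧ InLetters j i W ∧ StartsWith i W then
        [rightBraid n i j V W] else []) ++
  ((List.finRange n).flatMap fun s => (List.finRange n).flatMap fun k =>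
    if k.val + 2 ≤ s.val ∧ u = [Letter.a s, Letter.a k] then [[Letter.a k, Letter.a s]] else []) ++
  (if u = leftDelta n (block (posPart u)) then [rightDelta n (block (posPart u))] else []) ++
  ((List.finRange n).flatMap fun l =>
    if u = [Letter.a l, Letter.delta] then [[Letter.delta, Letter.a l.rev]] else
    if u = [Letter.a l, Letter.deltaInv] then [[Letter.deltaInv, Letter.a l.rev]] else []) ++
  (if u = [Letter.delta, Letter.deltaInv] ∨ u = [Letter.deltaInv, Letter.delta] then [[]] else [])

/-- The list of all words obtained from `w` by one elimination of a leading word. -/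
def reducts {n : ℕ} (w : Word n) : List (Word n) :=
  (List.range (w.length + 1)).flatMap fun s => (List.range (w.length + 1)).flatMap fun t =>
    (rightSides ((w.drop s).take t)).map fun v => w.take s ++ v ++ (w.drop s).drop t

/-- One step of the algorithm: make the first possible elimination, if there is one. -/
def step {n : ℕ} (w : Word n) : Word n := (reducts w).head?.getD w

end ArtinGarside

/-! Existence comes from termination: each relation of `S` shortens the word or keeps its length and
lowers its first letter, so every sequence of eliminations ends at an irreducible word. Relations 4
and 5 force such a word to have the shape Δ^k A.

Uniqueness is not obtained by checking that overlaps of relations resolve, but by showing that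
irreducible positive words are minimal. Garside's lemma (`lcmForm_of_eq`) says that two generators
dividing an element have their obvious least common multiple dividing it; it gives left cancellation
and controls which generators divide a product. With it `SIrreducible.tame` shows that in an
irreducible positive word each letter is the least generator dividing the rest from there on. Such a
word is the least of its class (`Tame.eq_or_shortlex`), hence the only irreducible one in it.

If Δ divides a tame word, the word begins with a left-hand side of relation 3
(`Tame.exists_eq_leftDelta`), so the `A` of an irreducible Δ^k A is prime to Δ. Finally, Δ² is
central and a multiple of every generator, so the monoid embeds into its fractions by powers of Δ²,
and therefore into the braid group. This makes `k` and the class of `A` depend on `g` alone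
(`deltaForm_unique`), and both normal forms are the same word. -/

namespace ArtinGarside

/-! ### Left divisibility in the braid monoid -/

/-- The generator `a_x` of the braid monoid. -/
abbrev gen {n : ℕ} (x : Fin n) : BraidMonoid n := PresentedMonoid.of (ArtinRel n) x

/-- `a_x` and `a_y` commute. -/
def Far {n : ℕ} (x y : Fin n) : Prop := x.val + 2 ≤ y.val ∨ y.val + 2 ≤ x.val

/-- `a_x` and `a_y` satisfy the braid relation. -/
def Adj {n : ℕ} (x y : Fin n) : Prop := x.val + 1 = y.val ∨ y.val + 1 = x.val

theorem Far.symm {n : ℕ} {x y : Fin n} (h : Far x y) : Far y x := Or.symm h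

theorem Adj.symm {n : ℕ} {x y : Fin n} (h : Adj x y) : Adj y x := Or.symm h

theorem eq_or_far_or_adj {n : ℕ} (x y : Fin n) : x = y ∨ Far x y ∨ Adj x y := by
  unfold Far Adj
  rw [Fin.ext_iff]
  omega

@[simp] theorem monoidVal_nil {n : ℕ} : monoidVal ([] : PosWord n) = 1 := rfl

@[simp] theorem monoidVal_cons {n : ℕ} (x : Fin n) (A : PosWord n) :
    monoidVal (x :: A) = gen x * monoidVal A := by
  simp [monoidVal]

@[simp] theorem monoidVal_append {n : ℕ} (A B : PosWord n) :
    monoidVal (A ++ B) = monoidVal A * monoidVal B := by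
  simp [monoidVal]

theorem mk_ofList {n : ℕ} (A : PosWord n) :
    PresentedMonoid.mk (ArtinRel n) (FreeMonoid.ofList A) = monoidVal A := by
  induction A with
  | nil => rfl
  | cons x A ih => rw [FreeMonoid.ofList_cons, map_mul, ih, monoidVal_cons]; rfl

theorem exists_monoidVal {n : ℕ} (m : BraidMonoid n) : ∃ A : PosWord n, monoidVal A = m := by
  obtain ⟨a, rfl⟩ := PresentedMonoid.surjective_mk m
  exact ⟨FreeMonoid.toList a, (mk_ofList _).symm.trans (by rw [FreeMonoid.ofList_toList])⟩

theorem gen_far {n : ℕ} {x y : Fin n} (h : Far x y) : gen x * gen y = gen y * gen x := by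
  rcases h with h | h
  · exact (PresentedMonoid.mk_eq_mk_of_rel (ArtinRel.comm x y h)).symm
  · exact PresentedMonoid.mk_eq_mk_of_rel (ArtinRel.comm y x h)

theorem gen_adj {n : ℕ} {x y : Fin n} (h : Adj x y) :
    gen x * gen y * gen x = gen y * gen x * gen y := by
  rcases h with h | h
  · exact (PresentedMonoid.mk_eq_mk_of_rel (ArtinRel.braid x y h.symm)).symm
  · exact PresentedMonoid.mk_eq_mk_of_rel (ArtinRel.braid y x h.symm)

theorem gen_far_mul {n : ℕ} {x y : Fin n} (h : Far x y) (m : BraidMonoid n) :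
    gen x * (gen y * m) = gen y * (gen x * m) := by
  rw [← mul_assoc, gen_far h, mul_assoc]

theorem gen_adj_mul {n : ℕ} {x y : Fin n} (h : Adj x y) (m : BraidMonoid n) :
    gen x * (gen y * (gen x * m)) = gen y * (gen x * (gen y * m)) := by
  simp only [← mul_assoc, gen_adj h]

/-- The length homomorphism of the braid monoid. -/
def braidLength (n : ℕ) : BraidMonoid n →* Multiplicative ℕ :=
  PresentedMonoid.lift (fun _ => Multiplicative.ofAdd 1) (by
    rintro _ _ (⟨i, j, h⟩ | ⟨k, s, h⟩) <;> simp)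

theorem braidLength_monoidVal {n : ℕ} (A : PosWord n) :
    braidLength n (monoidVal A) = Multiplicative.ofAdd A.length := by
  induction A with
  | nil => simp
  | cons x A ih =>
    rw [monoidVal_cons, map_mul, ih, braidLength, PresentedMonoid.lift_of, ← ofAdd_add]
    simp [add_comm]

theorem length_eq_of_monoidVal_eq {n : ℕ} {A B : PosWord n} (h : monoidVal A = monoidVal B) :
    A.length = B.length := by
  have := congrArg (braidLength n) h
  rwa [braidLength_monoidVal, braidLength_monoidVal, Multiplicative.ofAdd.injective.eq_iff] at this

/-! ### Garside's lemma, by induction on length, and left cancellation -/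

/-- `a_x P` and `a_y Q` are written as a multiple of the least common multiple of `a_x` and
`a_y`. -/
def LcmForm {n : ℕ} (x : Fin n) (P : BraidMonoid n) (y : Fin n) (Q : BraidMonoid n) : Prop :=
  (x = y ∧ P = Q) ∨ (Far x y ∧ ∃ T, P = gen y * T ∧ Q = gen x * T) ∨
    (Adj x y ∧ ∃ T, P = gen y * (gen x * T) ∧ Q = gen x * (gen y * T))

theorem LcmForm.symm {n : ℕ} {x y : Fin n} {P Q : BraidMonoid n} (h : LcmForm x P y Q) :
    LcmForm y Q x P := by
  rcases h with ⟨h, e⟩ | ⟨h, T, e, f⟩ | ⟨h, T, e, f⟩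
  · exact .inl ⟨h.symm, e.symm⟩
  · exact .inr (.inl ⟨h.symm, T, f, e⟩)
  · exact .inr (.inr ⟨h.symm, T, f, e⟩)

theorem LcmForm.mul_right {n : ℕ} {x y : Fin n} {P Q : BraidMonoid n} (h : LcmForm x P y Q)
    (m : BraidMonoid n) : LcmForm x (P * m) y (Q * m) := by
  rcases h with ⟨h, e⟩ | ⟨h, T, e, f⟩ | ⟨h, T, e, f⟩
  · exact .inl ⟨h, by rw [e]⟩
  · exact .inr (.inl ⟨h, T * m, by rw [e, mul_assoc], by rw [f, mul_assoc]⟩)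
  · exact .inr (.inr ⟨h, T * m, by simp only [e, mul_assoc], by simp only [f, mul_assoc]⟩)

/-- Garside's lemma for elements of length less than `L`. -/
def LcmBelow (n L : ℕ) : Prop :=
  ∀ (x y : Fin n) (P Q : PosWord n), P.length < L →
    gen x * monoidVal P = gen y * monoidVal Q → LcmForm x (monoidVal P) y (monoidVal Q)

section Transitivity

variable {n L : ℕ}

/-- `m` has length less than `L`. -/
def Short {n : ℕ} (L : ℕ) (m : BraidMonoid n) : Prop :=
  ∃ A : PosWord n, monoidVal A = m ∧ A.length < L

theorem Short.of_gen_mul_succ {x : Fin n} {m : BraidMonoid n} (h : Short (L + 1) (gen x * m)) :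
    Short L m := by
  obtain ⟨A, hA, hl⟩ := h
  obtain ⟨B, rfl⟩ := exists_monoidVal m
  rw [← monoidVal_cons] at hA
  have := length_eq_of_monoidVal_eq hA
  exact ⟨B, rfl, by simp at this; omega⟩

theorem Short.of_gen_mul {x : Fin n} {m : BraidMonoid n} (h : Short L (gen x * m)) :
    Short L m := by
  obtain ⟨A, hA, hl⟩ := h
  exact Short.of_gen_mul_succ ⟨A, hA, hl.trans (Nat.lt_succ_self L)⟩

theorem LcmBelow.apply (H : LcmBelow n L) {x y : Fin n} {P Q : BraidMonoid n}
    (hP : Short L P) (h : gen x * P = gen y * Q) : LcmForm x P y Q := by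
  obtain ⟨A, rfl, hA⟩ := hP
  obtain ⟨B, rfl⟩ := exists_monoidVal Q
  exact H x y A B hA h

theorem LcmForm.cancel {x : Fin n} {P Q : BraidMonoid n} (h : LcmForm x P x Q) : P = Q := by
  rcases h with ⟨-, e⟩ | ⟨h, -⟩ | ⟨h, -⟩
  · exact e
  · unfold Far at h; omega
  · unfold Adj at h; omega

theorem LcmForm.far {x y : Fin n} {P Q : BraidMonoid n} (h : LcmForm x P y Q) (hxy : Far x y) :
    ∃ T, P = gen y * T ∧ Q = gen x * T := by
  rcases h with ⟨rfl, -⟩ | ⟨-, h⟩ | ⟨h, -⟩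
  · unfold Far at hxy; omega
  · exact h
  · unfold Far at hxy; unfold Adj at h; omega

theorem LcmForm.adj {x y : Fin n} {P Q : BraidMonoid n} (h : LcmForm x P y Q) (hxy : Adj x y) :
    ∃ T, P = gen y * (gen x * T) ∧ Q = gen x * (gen y * T) := by
  rcases h with ⟨rfl, -⟩ | ⟨h, -⟩ | ⟨-, h⟩
  · unfold Adj at hxy; omega
  · unfold Far at h; unfold Adj at hxy; omega
  · exact h

/-- The mixed case of `LcmForm.trans_below`; by symmetry it also covers `x` adjacent to `z` and `z`
far from `y`. -/
theorem LcmForm.trans_far_adj (H : LcmBelow n L) {x y z : Fin n} {X Y Z : BraidMonoid n}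
    (hZ : Short (L + 1) Z) (hxz : Far x z) (hzy : Adj z y) (h₁ : LcmForm x X z Z)
    (h₂ : LcmForm z Z y Y) : LcmForm x X y Y := by
  obtain ⟨P, rfl, rfl⟩ := h₁.far hxz
  obtain ⟨Q, hQ, rfl⟩ := h₂.adj hzy
  have hP := hZ.of_gen_mul_succ
  have hzQ : Short L (gen z * Q) := by rw [hQ] at hZ; exact hZ.of_gen_mul_succ
  have hQ' := hzQ.of_gen_mul
  rcases eq_or_far_or_adj x y with rfl | hxy | hxy
  · unfold Far at hxz; unfold Adj at hzy; omega
  · obtain ⟨T, rfl, hT⟩ := (H.apply hP hQ).far hxy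
    obtain ⟨U, rfl, rfl⟩ := (H.apply hQ' hT).far hxz.symm
    refine .inr (.inl ⟨hxy, gen z * (gen y * U), ?_, ?_⟩)
    · rw [gen_adj_mul hzy]
    · rw [gen_far_mul hxy.symm, gen_far_mul hxz]
  · obtain ⟨T, rfl, hT⟩ := (H.apply hP hQ).adj hxy
    obtain ⟨U, rfl, hU⟩ := (H.apply hQ' hT).far hxz.symm
    have hyT : Short L (gen y * T) := by rw [hT] at hzQ; exact hzQ.of_gen_mul
    obtain ⟨V, rfl, rfl⟩ := (H.apply hyT.of_gen_mul hU).adj hzy.symm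
    refine .inr (.inr ⟨hxy, gen z * (gen y * (gen x * V)), ?_, ?_⟩)
    · rw [gen_far_mul hxz, gen_adj_mul hzy, gen_adj_mul hxy.symm, gen_far_mul hxz]
    · rw [gen_adj_mul hxy.symm, gen_far_mul hxz, gen_far_mul hxz.symm, gen_adj_mul hzy]

/-- The heart of Garside's lemma. Both hypotheses factor `Z`, and after removal of a first letter
the factors are short enough for `H`, which compares the two factorizations. -/
theorem LcmForm.trans_below (H : LcmBelow n L) {x y z : Fin n} {X Y Z : BraidMonoid n}
    (hZ : Short (L + 1) Z) (h₁ : LcmForm x X z Z) (h₂ : LcmForm z Z y Y) : LcmForm x X y Y := by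
  rcases eq_or_far_or_adj x z with rfl | hxz | hxz
  · rwa [h₁.cancel]
  · rcases eq_or_far_or_adj z y with rfl | hzy | hzy
    · rwa [← h₂.cancel]
    · obtain ⟨P, rfl, rfl⟩ := h₁.far hxz
      obtain ⟨Q, hQ, rfl⟩ := h₂.far hzy
      rcases H.apply hZ.of_gen_mul_succ hQ with ⟨rfl, rfl⟩ | ⟨hxy, T, rfl, rfl⟩ | ⟨hxy, T, rfl, rfl⟩
      · exact .inl ⟨rfl, rfl⟩
      · exact .inr (.inl ⟨hxy, gen z * T, gen_far_mul hzy _, gen_far_mul hxz.symm _⟩)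
      · refine .inr (.inr ⟨hxy, gen z * T, ?_, ?_⟩)
        · rw [gen_far_mul hzy, gen_far_mul hxz]
        · rw [gen_far_mul hxz.symm, gen_far_mul hzy]
    · exact trans_far_adj H hZ hxz hzy h₁ h₂
  · rcases eq_or_far_or_adj z y with rfl | hzy | hzy
    · rwa [← h₂.cancel]
    · exact (trans_far_adj H hZ hzy.symm hxz.symm h₂.symm h₁.symm).symm
    · obtain ⟨P, rfl, rfl⟩ := h₁.adj hxz
      obtain ⟨Q, hQ, rfl⟩ := h₂.adj hzy
      have hzP := hZ.of_gen_mul_succ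
      have hzQ : Short L (gen z * Q) := by rw [hQ] at hZ; exact hZ.of_gen_mul_succ
      rcases H.apply hzP hQ with ⟨rfl, h⟩ | ⟨hxy, T, hP, hT⟩ | ⟨hxy, T, hP, hT⟩
      · rw [(H.apply hzP.of_gen_mul h).cancel]
        exact .inl ⟨rfl, rfl⟩
      -- Here `x` and `y` are the two neighbours of `z`. The outcome is T = a_z a_y a_x W, so that
      -- a_z Z is a multiple of the least common multiple of all three generators, which has length
      -- 6.
      · have hxT : Short L (gen x * T) := by rw [← hT]; exact hzQ
        obtain ⟨U, rfl, hU⟩ := (H.apply hzP.of_gen_mul hP).adj hzy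
        obtain ⟨V, rfl, hV⟩ := (H.apply hzQ.of_gen_mul hT).adj hxz.symm
        rw [hU] at hV hxT
        have e := (H.apply hxT.of_gen_mul.of_gen_mul.of_gen_mul
          (H.apply hxT.of_gen_mul.of_gen_mul hV).cancel)
        obtain ⟨W, rfl, rfl⟩ := e.far hxy.symm
        refine .inr (.inl ⟨hxy, gen z * (gen y * (gen x * (gen z * W))), ?_, ?_⟩)
        · rw [gen_far_mul hxy, gen_adj_mul hxz, gen_adj_mul hzy]
        · rw [gen_far_mul hxy.symm, gen_adj_mul hzy.symm, gen_adj_mul hxz.symm, gen_far_mul hxy]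
      -- Indices of two neighbours of `z` differ by 0 or 2, so the neighbours are not adjacent.
      · unfold Adj at hxz hzy hxy; omega

/-- Both words are empty, or the words have the same positive length and `LcmForm` holds for their
decompositions into the first letter and the rest. -/
def HeadLcm {n : ℕ} : PosWord n → PosWord n → Prop
  | [], [] => True
  | x :: A, y :: B => A.length = B.length ∧ LcmForm x (monoidVal A) y (monoidVal B)
  | _, _ => False

/-- Equality in the monoid is the congruence generated by Artin's relations, so it suffices that
`HeadLcm` holds for these and survives the closure rules. Transitivity is the only rule that needs
`H`. Relations preserve length, so the bound carries over to the intermediate words. -/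
theorem headLcm_of_rel (H : LcmBelow n L) {u v : FreeMonoid (Fin n)}
    (h : ConGen.Rel (ArtinRel n) u v) (hu : u.toList.length ≤ L + 1) :
    HeadLcm u.toList v.toList := by
  have length_eq {u v : FreeMonoid (Fin n)} (h : ConGen.Rel (ArtinRel n) u v) :
      u.toList.length = v.toList.length := by
    apply length_eq_of_monoidVal_eq
    rw [← mk_ofList, ← mk_ofList]
    exact PresentedMonoid.mk_eq_mk_iff.2 h
  induction h with
  | of x y h =>
    rcases h with ⟨i, j, h⟩ | ⟨k, s, h⟩
    · exact ⟨rfl, .inr (.inr ⟨.inr h.symm, 1, by simp, by simp⟩)⟩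
    · exact ⟨rfl, .inr (.inl ⟨.inr h, 1, by simp, by simp⟩)⟩
  | refl x =>
    rcases x.toList with _ | ⟨a, A⟩
    · trivial
    · exact ⟨rfl, .inl ⟨rfl, rfl⟩⟩
  | @symm x y h ih =>
    specialize ih ((length_eq h).trans_le hu)
    revert ih
    rcases x.toList with _ | ⟨a, A⟩ <;> rcases y.toList with _ | ⟨b, B⟩ <;> intro ih
    · trivial
    · exact ih.elim
    · exact ih.elim
    · exact ⟨ih.1.symm, ih.2.symm⟩
  | @trans x y z h₁ h₂ ih₁ ih₂ =>
    have hy := (length_eq h₁).symm.trans_le hu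
    specialize ih₁ hu
    specialize ih₂ hy
    revert ih₁ ih₂ hy
    rcases x.toList with _ | ⟨a, A⟩ <;> rcases y.toList with _ | ⟨b, B⟩ <;>
      rcases z.toList with _ | ⟨c, C⟩ <;> intro ih₁ ih₂ hy <;>
      first | trivial | exact ih₁.elim | exact ih₂.elim | skip
    exact ⟨ih₁.1.trans ih₂.1, ih₁.2.trans_below H ⟨B, rfl, by simpa using hy⟩ ih₂.2⟩
  | @mul w x y z h₁ h₂ ih₁ ih₂ =>
    rw [FreeMonoid.toList_mul, List.length_append] at hu
    have hl := length_eq h₂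
    specialize ih₁ (by omega)
    specialize ih₂ (by omega)
    have e : monoidVal y.toList = monoidVal z.toList := by
      rw [← mk_ofList, ← mk_ofList]
      exact PresentedMonoid.mk_eq_mk_iff.2 h₂
    rw [FreeMonoid.toList_mul, FreeMonoid.toList_mul]
    revert ih₁
    -- If the left factors are empty, the right factors decide; otherwise the first letters lie in
    -- the left factors and the tails are multiplied by equal elements.
    rcases w.toList with _ | ⟨a, A⟩ <;> rcases x.toList with _ | ⟨b, B⟩ <;> intro ih₁
    · exact ih₂
    · exact ih₁.elim
    · exact ih₁.elim
    · refine ⟨by simp [ih₁.1, hl], ?_⟩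
      change LcmForm a (monoidVal (A ++ _)) b (monoidVal (B ++ _))
      rw [monoidVal_append, monoidVal_append, e]
      exact ih₁.2.mul_right _

theorem lcmBelow (n L : ℕ) : LcmBelow n L := by
  induction L with
  | zero => exact fun x y P Q h => absurd h (Nat.not_lt_zero _)
  | succ L ih =>
    intro x y P Q hP h
    rw [← monoidVal_cons, ← monoidVal_cons, ← mk_ofList, ← mk_ofList] at h
    exact (headLcm_of_rel ih (PresentedMonoid.mk_eq_mk_iff.1 h) hP).2

end Transitivity

/-- Garside's lemma. -/
theorem lcmForm_of_eq {n : ℕ} {x y : Fin n} {P Q : BraidMonoid n} (h : gen x * P = gen y * Q) :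
    LcmForm x P y Q := by
  obtain ⟨A, rfl⟩ := exists_monoidVal P
  exact (lcmBelow n _).apply ⟨A, rfl, Nat.lt_succ_self _⟩ h

theorem gen_mul_cancel {n : ℕ} {x : Fin n} {P Q : BraidMonoid n} (h : gen x * P = gen x * Q) :
    P = Q :=
  (lcmForm_of_eq h).cancel

instance {n : ℕ} : IsLeftCancelMul (BraidMonoid n) where
  mul_left_cancel m P Q h := by
    obtain ⟨A, rfl⟩ := exists_monoidVal m
    induction A with
    | nil => simpa using h
    | cons x A ih =>
      simp only [monoidVal_cons, mul_assoc] at h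
      exact ih (gen_mul_cancel h)

variable {n : ℕ}

/-! ### The words `a_{ij}` -/

theorem mem_desc {i j : ℕ} {x : Fin n} : x ∈ desc n i j ↔ j ≤ x.val + 1 ∧ x.val + 1 ≤ i := by
  simp [desc]

theorem desc_eq_nil {i j : ℕ} (h : i < j) : desc n i j = [] := by
  rw [List.eq_nil_iff_forall_not_mem]
  intro x hx
  rw [mem_desc] at hx
  omega

theorem pairwise_desc (i j : ℕ) : (desc n i j).Pairwise (· > ·) := by
  rw [desc, List.pairwise_reverse]
  exact (List.pairwise_lt_finRange n).filter _

theorem eq_desc {i j : ℕ} {A : PosWord n} (hA : A.Pairwise (· > ·))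
    (h : ∀ x, x ∈ A ↔ j ≤ x.val + 1 ∧ x.val + 1 ≤ i) : desc n i j = A :=
  (pairwise_desc i j).eq_of_mem_iff hA fun x => by rw [mem_desc, h]

theorem desc_append {i j m : ℕ} (h₁ : j ≤ m + 1) (h₂ : m ≤ i) :
    desc n i j = desc n i (m + 1) ++ desc n m j := by
  apply eq_desc
  · rw [List.pairwise_append]
    refine ⟨pairwise_desc _ _, pairwise_desc _ _, fun x hx y hy => ?_⟩
    rw [mem_desc] at hx hy
    rw [gt_iff_lt, Fin.lt_def]
    omega
  · intro x
    rw [List.mem_append, mem_desc, mem_desc]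
    omega

theorem desc_self (x : Fin n) : desc n (x.val + 1) (x.val + 1) = [x] := by
  apply eq_desc (List.pairwise_singleton _ _)
  intro y
  rw [List.mem_singleton, Fin.ext_iff]
  omega

theorem desc_succ {x : Fin n} {j : ℕ} (h : j ≤ x.val + 1) :
    desc n (x.val + 1) j = x :: desc n x.val j := by
  rw [desc_append h (Nat.le_succ _), desc_self]
  rfl

theorem desc_split {i j : ℕ} {x y : Fin n} (hxy : x.val + 1 = y.val) (h₁ : j ≤ x.val + 1)
    (h₂ : y.val + 1 ≤ i) :
    desc n i j = desc n i (y.val + 2) ++ y :: x :: desc n x.val j := by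
  rw [desc_append (m := y.val + 1) (by omega) h₂, desc_succ (by omega), ← hxy, desc_succ h₁]

/-! ### Words all of whose letters commute with a given generator -/

theorem gen_mul_of_far {k : Fin n} {D : PosWord n} (h : ∀ x ∈ D, Far k x) :
    gen k * monoidVal D = monoidVal D * gen k := by
  induction D with
  | nil => simp
  | cons x D ih =>
    rw [List.forall_mem_cons] at h
    rw [monoidVal_cons, gen_far_mul h.1, ih h.2, mul_assoc]

/-- Garside's lemma, applied to one letter of `D` after another: D a_k = a_k D is a least common
multiple. -/
theorem exists_of_far_mul {k : Fin n} {D : PosWord n} (h : ∀ x ∈ D, Far k x)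
    {c P : BraidMonoid n} (e : monoidVal D * c = gen k * P) :
    ∃ T, P = monoidVal D * T ∧ c = gen k * T := by
  induction D generalizing P with
  | nil => exact ⟨P, by simp, by simpa using e⟩
  | cons x D ih =>
    rw [List.forall_mem_cons] at h
    rw [monoidVal_cons, mul_assoc] at e
    obtain ⟨T, hT, rfl⟩ := (lcmForm_of_eq e).far h.1.symm
    obtain ⟨U, rfl, rfl⟩ := ih h.2 hT
    exact ⟨U, by rw [monoidVal_cons, mul_assoc], rfl⟩

/-! ### Common multiples of a generator and `a_{ij}` -/

/-- With `desc_dvd_extend` and `desc_dvd_of_mem` this describes how the divisor a_{ij} changes when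
a first letter a_l (1-based) is removed: it stays for l ≤ j - 2 and for j ≤ l < i, and grows to
a_{i,j-1} for l = j - 1. -/
theorem desc_dvd_of_far {i j : ℕ} {k : Fin n} (hk : k.val + 3 ≤ j) {P : BraidMonoid n}
    (h : monoidVal (desc n i j) ∣ gen k * P) : monoidVal (desc n i j) ∣ P := by
  obtain ⟨c, e⟩ := h
  obtain ⟨T, rfl, -⟩ := exists_of_far_mul (fun x hx => by
    rw [mem_desc] at hx; left; omega) e.symm
  exact ⟨T, rfl⟩

theorem desc_dvd_extend {i j : ℕ} {k : Fin n} (hk : k.val + 2 = j) (hi : j ≤ i) (hn : i ≤ n)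
    {P : BraidMonoid n} (h : monoidVal (desc n i j) ∣ gen k * P) :
    monoidVal (desc n i (j - 1)) ∣ P := by
  obtain ⟨c, e⟩ := h
  let y : Fin n := ⟨k.val + 1, by omega⟩
  have hyk : y.val = k.val + 1 := rfl
  subst hk
  have hy : desc n i (k.val + 2) = desc n i (y.val + 2) ++ [y] := by
    rw [desc_append (m := y.val + 1) (by omega) (by omega)]
    congr 1
    exact desc_self y
  have hk' : desc n i (k.val + 2 - 1) = desc n i (y.val + 2) ++ [y, k] := by
    rw [desc_split (x := k) (y := y) rfl (by omega) (by omega),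
      desc_eq_nil (i := k.val) (by omega)]
  rw [hy, monoidVal_append, mul_assoc] at e
  obtain ⟨T, rfl, hT⟩ := exists_of_far_mul (fun x hx => by
    rw [mem_desc] at hx; left; omega) e.symm
  rw [monoidVal_cons, monoidVal_nil, mul_one] at hT
  obtain ⟨U, -, rfl⟩ := (lcmForm_of_eq hT).adj (.inr rfl)
  exact ⟨U, by rw [hk']; simp [mul_assoc]⟩

/-- Write a_{ij} = D a_y a_x E. The letter a_x commutes with `D`, becomes a_y at the braid relation,
and a_y commutes with `E`. Garside's lemma forces each passage, so a_x a_{ij} = a_{ij} a_y is a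
least common multiple. -/
theorem exists_of_desc_mul_eq {i j : ℕ} {x y : Fin n} (hxy : x.val + 1 = y.val)
    (h₁ : j ≤ x.val + 1) (h₂ : y.val + 1 ≤ i) {c P : BraidMonoid n}
    (e : monoidVal (desc n i j) * c = gen x * P) :
    ∃ T, P = monoidVal (desc n i j) * T ∧ c = gen y * T := by
  rw [desc_split hxy h₁ h₂, monoidVal_append, mul_assoc] at e
  obtain ⟨T, rfl, hT⟩ := exists_of_far_mul (fun x hx => by
    rw [mem_desc] at hx; left; omega) e
  rw [monoidVal_cons, monoidVal_cons, mul_assoc, mul_assoc] at hT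
  obtain ⟨U, hU, rfl⟩ := (lcmForm_of_eq hT).adj (.inr hxy)
  obtain ⟨V, rfl, rfl⟩ := exists_of_far_mul (fun z hz => by
    rw [mem_desc] at hz; right; omega) (gen_mul_cancel hU)
  refine ⟨V, ?_, rfl⟩
  rw [desc_split hxy h₁ h₂]
  simp [mul_assoc]

theorem desc_dvd_of_mem {i j : ℕ} {k : Fin n} (h₁ : j ≤ k.val + 1) (h₂ : k.val + 2 ≤ i)
    (hn : i ≤ n) {P : BraidMonoid n} (h : monoidVal (desc n i j) ∣ gen k * P) :
    monoidVal (desc n i j) ∣ P := by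
  obtain ⟨c, e⟩ := h
  obtain ⟨T, rfl, -⟩ :=
    exists_of_desc_mul_eq (y := ⟨k.val + 1, by omega⟩) rfl h₁ h₂ e.symm
  exact ⟨T, rfl⟩

/-! ### Moving words through `a_{ij}` -/

theorem gen_mul_desc {i j : ℕ} {x y : Fin n} (hxy : x.val + 1 = y.val) (h₁ : j ≤ x.val + 1)
    (h₂ : y.val + 1 ≤ i) :
    gen x * monoidVal (desc n i j) = monoidVal (desc n i j) * gen y := by
  rw [desc_split hxy h₁ h₂, monoidVal_append, monoidVal_cons, monoidVal_cons, ← mul_assoc,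
    gen_mul_of_far (fun z hz => by rw [mem_desc] at hz; left; omega)]
  have := gen_mul_of_far (k := y) (D := desc n x.val j)
    (fun z hz => by rw [mem_desc] at hz; right; omega)
  simp only [mul_assoc, ← this]
  rw [gen_adj_mul (.inl hxy)]

theorem shift_nil (k : ℕ) : shift k ([] : PosWord n) = [] := rfl

theorem shift_cons (k : ℕ) (x : Fin n) (A : PosWord n) :
    shift k (x :: A) = ⟨(x.val + k) % n, Nat.mod_lt _ x.pos⟩ :: shift k A := rfl

theorem inLetters_nil (j i : ℕ) : InLetters j i ([] : PosWord n) := by simp [InLetters]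

theorem inLetters_cons {j i : ℕ} {x : Fin n} {A : PosWord n} :
    InLetters j i (x :: A) ↔ (j ≤ x.val + 1 ∧ x.val + 1 ≤ i) ∧ InLetters j i A :=
  List.forall_mem_cons

theorem word_mul_desc {i j : ℕ} (hn : i + 1 ≤ n) {W : PosWord n} (hW : InLetters j i W) :
    monoidVal W * monoidVal (desc n (i + 1) j)
      = monoidVal (desc n (i + 1) j) * monoidVal (shift 1 W) := by
  induction W with
  | nil => simp [shift_nil]
  | cons x W ih =>
    rw [inLetters_cons] at hW
    rw [shift_cons, monoidVal_cons, monoidVal_cons, mul_assoc, ih hW.2, ← mul_assoc,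
      gen_mul_desc (y := ⟨(x.val + 1) % n, Nat.mod_lt _ x.pos⟩)
        (Nat.mod_eq_of_lt (by omega)).symm hW.1.1, mul_assoc]
    change (x.val + 1) % n + 1 ≤ i + 1
    rw [Nat.mod_eq_of_lt (by omega)]
    omega

/-- Both sides of the first family of relations represent the same element. -/
theorem braid_relation {i j : ℕ} {V W : PosWord n} (hi : 1 ≤ i) (hin : i + 1 ≤ n)
    (hji : j ≤ i + 1) (hV : InLetters 1 (i - 1) V) (hW : InLetters j i W) :
    monoidVal (desc n (i + 1) i ++ V ++ W ++ desc n (i + 1) j) =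
      monoidVal (desc n i i ++ desc n (i + 1) i ++ V ++ desc n i j ++ shift 1 W) := by
  obtain ⟨i, rfl⟩ := Nat.exists_eq_add_of_le' hi
  let x : Fin n := ⟨i, by omega⟩
  let y : Fin n := ⟨i + 1, by omega⟩
  have h₁ : desc n (i + 1) (i + 1) = [x] := desc_self x
  have h₂ : desc n (i + 1 + 1) (i + 1) = [y, x] := by
    have := desc_succ (x := y) (j := i + 1) (by simp [y])
    rw [h₁] at this
    exact this
  have h₃ : desc n (i + 1 + 1) j = y :: desc n (i + 1) j := desc_succ (x := y) hji
  have h₄ := gen_mul_of_far (k := y) (D := V) fun z hz => by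
    have := hV z hz
    right
    simp only [y]
    omega
  have h₅ := word_mul_desc hin hW
  rw [h₁, h₂]
  simp only [monoidVal_append, mul_assoc] at h₅ ⊢
  rw [h₅, h₃]
  simp only [monoidVal_cons, monoidVal_nil, mul_one, mul_assoc]
  rw [← mul_assoc (monoidVal V), ← h₄]
  simp only [mul_assoc]
  rw [gen_adj_mul (x := y) (y := x) (.inr rfl)]

/-! ### Irreducible positive words are minimal -/

/-- No letter of the word is followed by a letter that is smaller by two or more, and each letter is
the smallest generator that divides the rest of the word beginning with it. -/
def Tame : PosWord n → Prop
  | [] => True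
  | x :: w => (∀ y ∈ w.head?, x.val ≤ y.val + 1) ∧
      (∀ y, gen y ∣ monoidVal (x :: w) → x ≤ y) ∧ Tame w

theorem Tame.of_append {u w : PosWord n} (h : Tame (u ++ w)) : Tame w := by
  induction u with
  | nil => exact h
  | cons x u ih => exact ih h.2.2

theorem not_gen_dvd_one (x : Fin n) : ¬ gen x ∣ (1 : BraidMonoid n) := by
  rintro ⟨c, h⟩
  obtain ⟨A, rfl⟩ := exists_monoidVal c
  rw [← monoidVal_cons, ← monoidVal_nil] at h
  simpa using length_eq_of_monoidVal_eq h

theorem exists_cons_of_gen_dvd {x : Fin n} {w : PosWord n} (h : gen x ∣ monoidVal w) :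
    ∃ z w', w = z :: w' := by
  rcases w with _ | ⟨z, w⟩
  · exact (not_gen_dvd_one x h).elim
  · exact ⟨z, w, rfl⟩

theorem dvd_of_gen_mul_dvd {x : Fin n} {P Q : BraidMonoid n} (h : gen x * P ∣ gen x * Q) :
    P ∣ Q := by
  obtain ⟨c, hc⟩ := h
  exact ⟨c, gen_mul_cancel (by rw [hc, mul_assoc])⟩

theorem gen_dvd_desc {x : Fin n} {j : ℕ} (h : j ≤ x.val + 1) :
    gen x ∣ monoidVal (desc n (x.val + 1) j) := by
  rw [desc_succ h, monoidVal_cons]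
  exact dvd_mul_right _ _

/-- Once `x` is cancelled, the next lower generator divides `w` unless the descending word is used
up. Tameness then bounds the first letter of `w` from above by that generator, and from below
because no drop exceeds one. So the letters are forced in turn. -/
theorem Tame.exists_eq_desc_append {x : Fin n} {j : ℕ} (hj : j ≤ x.val + 1) {w : PosWord n}
    (hw : Tame (x :: w)) (h : monoidVal (desc n (x.val + 1) j) ∣ monoidVal (x :: w)) :
    ∃ r, x :: w = desc n (x.val + 1) j ++ r := by
  induction hm : x.val generalizing x w with
  | zero =>
    rw [hm] at hj
    have e : desc n (0 + 1) j = [x] := by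
      rw [← hm, desc_succ (by omega), hm, desc, List.filter_eq_nil_iff.2 (by simp)]
      rfl
    exact ⟨w, by rw [e]; rfl⟩
  | succ m ih =>
    rw [← hm]
    rw [desc_succ hj] at h ⊢
    rw [monoidVal_cons, monoidVal_cons] at h
    have h := dvd_of_gen_mul_dvd h
    by_cases hlt : x.val < j
    · exact ⟨w, by rw [desc_eq_nil hlt]; rfl⟩
    let y : Fin n := ⟨m, by omega⟩
    have hy : x.val = y.val + 1 := hm
    rw [hy] at h ⊢
    have hd := (gen_dvd_desc (x := y) (by omega)).trans h
    obtain ⟨z, w, rfl⟩ := exists_cons_of_gen_dvd hd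
    have h₁ : z ≤ y := hw.2.2.2.1 _ hd
    have h₂ : x.val ≤ z.val + 1 := hw.1 z rfl
    obtain rfl : y = z := le_antisymm (by rw [Fin.le_def]; omega) h₁
    obtain ⟨r, hr⟩ := ih (x := y) (by omega) hw.2.2 h rfl
    exact ⟨r, by rw [List.cons_append]; exact congrArg _ hr⟩

/-- Read `w` up to the first a_{i+1}. Letters before it are below a_{i+1}, which divides what
remains, and not below a_{j-1}, since the preceding letter `p` is at least a_j and drops are by at
most one. A letter a_{j-1} lowers `j` by one; the others keep a_{i+1,j} as a divisor. -/
theorem Tame.exists_eq_append_desc {i j : ℕ} (hin : i + 1 ≤ n) {p : Fin n} {w : PosWord n}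
    (hw : Tame (p :: w)) (hj : 1 ≤ j) (hjp : j ≤ p.val + 1) (hpi : p.val + 1 ≤ i)
    (h : monoidVal (desc n (i + 1) j) ∣ monoidVal w) :
    ∃ (W : PosWord n) (j' : ℕ) (r : PosWord n), 1 ≤ j' ∧ j' ≤ j ∧ InLetters j' i W ∧
      w = W ++ desc n (i + 1) j' ++ r := by
  let y : Fin n := ⟨i, by omega⟩
  have hyi : y.val = i := rfl
  clear_value y
  induction w generalizing p j with
  | nil =>
    exact (not_gen_dvd_one y ((gen_dvd_desc (x := y) (j := j) (by omega)).trans (hyi ▸ h))).elim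
  | cons z w ih =>
    have hzy : z ≤ y := hw.2.2.2.1 _ ((gen_dvd_desc (x := y) (j := j) (by omega)).trans (hyi ▸ h))
    rw [Fin.le_def] at hzy
    have hpz : p.val ≤ z.val + 1 := hw.1 z rfl
    rcases eq_or_ne z y with rfl | hne
    · subst hyi
      obtain ⟨r, hr⟩ := hw.2.2.exists_eq_desc_append (j := j) (by omega) h
      exact ⟨[], j, r, hj, le_rfl, inLetters_nil _ _, hr⟩
    rw [Ne, Fin.ext_iff] at hne
    rw [monoidVal_cons] at h
    by_cases hzj : j ≤ z.val + 1
    · obtain ⟨W, j', r, h₁, h₂, h₃, rfl⟩ := ih hw.2.2 hj hzj (by omega)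
        (desc_dvd_of_mem hzj (by omega) hin h)
      exact ⟨z :: W, j', r, h₁, h₂, inLetters_cons.2 ⟨⟨by omega, by omega⟩, h₃⟩, rfl⟩
    · obtain ⟨W, j', r, h₁, h₂, h₃, rfl⟩ := ih hw.2.2 (j := j - 1) (by omega) (by omega) (by omega)
        (desc_dvd_extend (by omega) (by omega) hin h)
      exact ⟨z :: W, j', r, h₁, by omega, inLetters_cons.2 ⟨⟨by omega, by omega⟩, h₃⟩, rfl⟩

/-- This finds the tail of a left-hand side of relation 1, with i = `y.val`, so that `y` stands for
a_{i+1}. Letters below a_i commute with a_{i+1} and make up `V`; an a_i met before a_{i+1} opens `W`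
and turns the divisor into a_{i+1} a_i. -/
theorem Tame.exists_eq_append_append_desc {y : Fin n} {w : PosWord n} (hy : 1 ≤ y.val)
    (hw : Tame w) (h : gen y ∣ monoidVal w) :
    ∃ (V W : PosWord n) (j : ℕ) (r : PosWord n), 1 ≤ j ∧ j ≤ y.val + 1 ∧
      InLetters 1 (y.val - 1) V ∧ InLetters j y.val W ∧ StartsWith y.val W ∧
      w = V ++ W ++ desc n (y.val + 1) j ++ r := by
  induction w with
  | nil => exact (not_gen_dvd_one y h).elim
  | cons z w ih =>
    have hzy : z ≤ y := hw.2.1 _ h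
    rw [Fin.le_def] at hzy
    rcases eq_or_ne z y with rfl | hne
    · exact ⟨[], [], z.val + 1, w, by omega, le_rfl, inLetters_nil _ _, inLetters_nil _ _,
        by simp [StartsWith], by simp [desc_self]⟩
    rw [Ne, Fin.ext_iff] at hne
    rw [monoidVal_cons] at h
    have e : monoidVal (desc n (y.val + 1) (y.val + 1)) = gen y := by simp [desc_self]
    by_cases hz : z.val + 1 = y.val
    · rw [← e] at h
      obtain ⟨W, j, r, h₁, h₂, h₃, rfl⟩ := hw.exists_eq_append_desc (i := y.val) (j := y.val)
        (by omega) hy hz.ge (by omega) (desc_dvd_extend (by omega) (by omega) (by omega) h)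
      exact ⟨[], z :: W, j, r, h₁, by omega, inLetters_nil _ _,
        inLetters_cons.2 ⟨⟨by omega, by omega⟩, h₃⟩, by simpa [StartsWith] using hz, rfl⟩
    · rw [← e] at h
      have h := desc_dvd_of_far (by omega) h
      rw [e] at h
      obtain ⟨V, W, j, r, h₁, h₂, h₃, h₄, h₅, rfl⟩ := ih hw.2.2 h
      exact ⟨z :: V, W, j, r, h₁, h₂, inLetters_cons.2 ⟨⟨by omega, by omega⟩, h₃⟩, h₄, h₅, rfl⟩

theorem pos_append (A B : PosWord n) : pos (A ++ B) = pos A ++ pos B := List.map_append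

theorem SIrreducible.of_append_append {u v w : Word n} (h : SIrreducible (u ++ v ++ w)) :
    SIrreducible v := by
  intro p l r q hS e
  exact h (u ++ p) l r (q ++ w) hS (by rw [e]; simp)

theorem SIrreducible.of_cons {x : Letter n} {w : Word n} (h : SIrreducible (x :: w)) :
    SIrreducible w :=
  SIrreducible.of_append_append (u := [x]) (w := []) (by simpa using h)

theorem SIrreducible.not_S {u v w l r : Word n} (h : SIrreducible w) (e : w = u ++ l ++ v) :
    ¬ S n l r :=
  fun hS => h u l r v hS e

/-- Let y < x divide the value of `x :: w`, with `w` tame. If the generators commute, `y` divides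
`w`, whose first letter is then at most `y`: a drop excluded by relation 2. If they are adjacent,
`w` begins with `y`, and `x` divides what follows, so a left-hand side of relation 1 appears. -/
theorem SIrreducible.tame {w : PosWord n} (h : SIrreducible (pos w)) : Tame w := by
  induction w with
  | nil => trivial
  | cons x w ih =>
    have hw := ih h.of_cons
    have hc : ∀ y ∈ w.head?, x.val ≤ y.val + 1 := by
      intro y hy
      obtain ⟨w', rfl⟩ := List.head?_eq_some_iff.1 hy
      by_contra hlt
      exact h.not_S (u := []) (v := pos w') rfl (S.comm x y (by omega))
    refine ⟨hc, fun y hy => ?_, hw⟩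
    by_contra hlt
    rw [not_le, Fin.lt_def] at hlt
    obtain ⟨c, hxy⟩ := hy
    rw [monoidVal_cons] at hxy
    have hle : ∀ z w', w = z :: w' → gen y ∣ monoidVal w →
        x.val ≤ y.val + 1 ∧ x.val ≤ z.val + 1 ∧ z.val ≤ y.val := by
      rintro z w' rfl hd
      have h₁ : z ≤ y := hw.2.1 y hd
      have h₂ := hc z rfl
      rw [Fin.le_def] at h₁
      omega
    rcases lcmForm_of_eq hxy with ⟨rfl, -⟩ | ⟨hf, T, hT, -⟩ | ⟨ha, T, hT, -⟩
    · omega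
    · have hd : gen y ∣ monoidVal w := ⟨T, hT⟩
      obtain ⟨z, w', rfl⟩ := exists_cons_of_gen_dvd hd
      have := hle z w' rfl hd
      unfold Far at hf
      omega
    · have hd : gen y ∣ monoidVal w := ⟨_, hT⟩
      obtain ⟨z, w', rfl⟩ := exists_cons_of_gen_dvd hd
      have hz := hle z w' rfl hd
      unfold Adj at ha
      obtain rfl : z = y := Fin.ext (by omega)
      rw [monoidVal_cons] at hT
      have hx : gen x ∣ monoidVal w' := ⟨T, gen_mul_cancel hT⟩
      obtain ⟨V, W, j, r, h₁, h₂, h₃, h₄, h₅, rfl⟩ :=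
        hw.2.2.exists_eq_append_append_desc (by omega) hx
      refine h.not_S (u := []) (v := pos r) ?_
        (S.braid x.val j V W (by omega) (by omega) h₁ h₂ h₃ h₄ h₅)
      have e : desc n (x.val + 1) x.val = [x, z] := by
        rw [desc_succ (by omega)]
        have : x.val = z.val + 1 := by omega
        rw [this, desc_self]
      rw [leftBraid, List.nil_append, ← pos_append, e]
      simp

/-! ### Tame words are the least words of their classes -/

theorem Tame.eq_or_shortlex {A B : PosWord n} (hA : Tame A) (h : monoidVal A = monoidVal B) :
    A = B ∨ List.Shortlex (· < ·) A B := by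
  have hl := length_eq_of_monoidVal_eq h
  suffices A = B ∨ List.Lex (· < ·) A B from this.imp_right (List.Shortlex.of_lex hl)
  induction A generalizing B with
  | nil => exact .inl (List.length_eq_zero_iff.1 hl.symm).symm
  | cons x A ih =>
    rcases B with _ | ⟨y, B⟩
    · simp at hl
    rcases (hA.2.1 y ⟨_, h.trans (monoidVal_cons y B)⟩).eq_or_lt with rfl | hlt
    · rw [monoidVal_cons, monoidVal_cons] at h
      rcases ih hA.2.2 (gen_mul_cancel h) (by simpa using hl) with rfl | h'
      · exact .inl rfl
      · exact .inr (.cons h')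
    · exact .inr (.rel hlt)

theorem Tame.eq_of_monoidVal_eq {A B : PosWord n} (hA : Tame A) (hB : Tame B)
    (h : monoidVal A = monoidVal B) : A = B := by
  rcases hA.eq_or_shortlex h with e | h₁
  · exact e
  · rcases hB.eq_or_shortlex h.symm with e | h₂
    · exact e.symm
    · exact (asymm h₁ h₂).elim

/-! ### The words `Λ_m Λ_{m+1} ⋯ Λ_n` -/

/-- The word `Λ_m Λ_{m+1} ⋯ Λ_n`. -/
def lambdaTail (n m : ℕ) : PosWord n := (List.range' m (n + 1 - m)).flatMap (lambdaWord n)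

theorem lambdaTail_one : lambdaTail n 1 = deltaWord n := rfl

theorem lambdaTail_of_lt {m : ℕ} (h : n < m) : lambdaTail n m = [] := by
  rw [lambdaTail, Nat.sub_eq_zero_of_le h]
  rfl

theorem lambdaTail_eq_append {m : ℕ} (h : m ≤ n) :
    lambdaTail n m = lambdaWord n m ++ lambdaTail n (m + 1) := by
  rw [lambdaTail, lambdaTail, show n + 1 - m = n + 1 - (m + 1) + 1 by omega, List.range'_succ,
    List.flatMap_cons]

theorem shift_zero (A : PosWord n) : shift 0 A = A := by
  induction A with
  | nil => rfl
  | cons x A ih =>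
    rw [shift_cons, ih]
    exact congrArg (· :: A) (Fin.ext (Nat.mod_eq_of_lt x.isLt))

theorem shift_shift (k l : ℕ) (A : PosWord n) : shift k (shift l A) = shift (l + k) A := by
  induction A with
  | nil => rfl
  | cons x A ih =>
    simp only [shift_cons, ih]
    congr 2
    rw [Nat.mod_add_mod, add_assoc]

theorem InLetters.shift {j i k : ℕ} (hn : i + k ≤ n) {A : PosWord n} (h : InLetters j i A) :
    InLetters (j + k) (i + k) (shift k A) := by
  induction A with
  | nil => exact inLetters_nil _ _
  | cons x A ih =>
    rw [inLetters_cons] at h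
    rw [shift_cons, inLetters_cons]
    refine ⟨?_, ih h.2⟩
    change _ ≤ (x.val + k) % n + 1 ∧ (x.val + k) % n + 1 ≤ _
    rw [Nat.mod_eq_of_lt (by omega)]
    omega

theorem InLetters.mono {j i j' i' : ℕ} (hj : j' ≤ j) (hi : i ≤ i') {A : PosWord n}
    (h : InLetters j i A) : InLetters j' i' A := fun x hx =>
  ⟨hj.trans (h x hx).1, (h x hx).2.trans hi⟩

theorem inLetters_desc (i j : ℕ) : InLetters j i (desc n i j) := fun _ hx => mem_desc.1 hx

theorem shift_desc {i j : ℕ} (hj : 1 ≤ j) (h : i + 1 ≤ n) :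
    shift 1 (desc n i j) = desc n (i + 1) (j + 1) := by
  symm
  apply eq_desc
  · rw [shift, List.pairwise_map]
    refine (pairwise_desc i j).imp_of_mem fun {x y} hx hy hlt => ?_
    rw [mem_desc] at hx hy
    rw [gt_iff_lt, Fin.lt_def] at hlt ⊢
    change (y.val + 1) % n < (x.val + 1) % n
    rw [Nat.mod_eq_of_lt (by omega), Nat.mod_eq_of_lt (by omega)]
    omega
  · intro x
    constructor
    · intro hx
      exact (inLetters_desc i j).shift h x hx
    · intro hx
      rw [shift, List.mem_map]
      refine ⟨⟨x.val - 1, by omega⟩, mem_desc.2 (by simp only; omega), Fin.ext ?_⟩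
      change (x.val - 1 + 1) % n = x.val
      rw [Nat.sub_add_cancel (by omega), Nat.mod_eq_of_lt x.isLt]

/-- Passing each of the n - m factors Λ_{m+1}, …, Λ_n raises the indices by one. -/
theorem word_mul_lambdaTail {m : ℕ} (hm : m ≤ n) {V : PosWord n} (hV : InLetters 1 m V) :
    monoidVal V * monoidVal (lambdaTail n (m + 1))
      = monoidVal (lambdaTail n (m + 1)) * monoidVal (shift (n - m) V) := by
  induction hd : n - m generalizing m V with
  | zero => rw [lambdaTail_of_lt (by omega)]; simp [shift_zero]
  | succ d ih =>
    rw [lambdaTail_eq_append (by omega), monoidVal_append, ← mul_assoc, lambdaWord,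
      word_mul_desc (by omega) hV, mul_assoc, ih (m := m + 1) (by omega)
      ((hV.shift (by omega)).mono (by omega) le_rfl) (by omega), shift_shift, mul_assoc,
      add_comm 1 d]

/-- Past Λ_m the letter has its index raised by one, hence is again strictly below the top letter of
the next factor Λ_{m+1}. -/
theorem lambdaTail_dvd_of_lt {m : ℕ} {k : Fin n} (hk : k.val + 2 ≤ m) {P : BraidMonoid n}
    (h : monoidVal (lambdaTail n m) ∣ gen k * P) : monoidVal (lambdaTail n m) ∣ P := by
  induction hd : n + 1 - m generalizing m k P with
  | zero => rw [lambdaTail_of_lt (by omega)]; simp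
  | succ d ih =>
    obtain ⟨c, e⟩ := h
    rw [lambdaTail_eq_append (by omega), monoidVal_append, mul_assoc, lambdaWord] at e
    obtain ⟨T, rfl, hT⟩ := exists_of_desc_mul_eq (y := ⟨k.val + 1, by omega⟩) rfl
      (by omega) hk e.symm
    obtain ⟨U, rfl⟩ := ih (m := m + 1) (k := ⟨k.val + 1, by omega⟩) (by simp only; omega)
      ⟨c, hT.symm⟩ (by omega)
    refine ⟨U, ?_⟩
    rw [lambdaTail_eq_append (m := m) (by omega), monoidVal_append, mul_assoc, lambdaWord]

/-! ### The relations with leading words `Λ_1 V_1 ⋯ Λ_{n-1} V_{n-1} Λ_n` -/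

/-- The word `Λ_m V_m ⋯ Λ_{n-1} V_{n-1} Λ_n`. -/
def leftTail (n : ℕ) (V : ℕ → PosWord n) (m : ℕ) : PosWord n :=
  (List.range' m (n - m)).flatMap (fun i => lambdaWord n i ++ V i) ++ lambdaWord n n

/-- The word `V_m^{(n-m)} ⋯ V_{n-1}'`. -/
def rightTail (n : ℕ) (V : ℕ → PosWord n) (m : ℕ) : PosWord n :=
  (List.range' m (n - m)).flatMap fun i => shift (n - i) (V i)

theorem leftTail_self (V : ℕ → PosWord n) : leftTail n V n = lambdaWord n n := by simp [leftTail]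

theorem leftTail_of_lt (V : ℕ → PosWord n) {m : ℕ} (h : m < n) :
    leftTail n V m = lambdaWord n m ++ V m ++ leftTail n V (m + 1) := by
  rw [leftTail, leftTail, show n - m = n - (m + 1) + 1 by omega, List.range'_succ,
    List.flatMap_cons, List.append_assoc]

theorem rightTail_self (V : ℕ → PosWord n) : rightTail n V n = [] := by simp [rightTail]

theorem rightTail_of_lt (V : ℕ → PosWord n) {m : ℕ} (h : m < n) :
    rightTail n V m = shift (n - m) (V m) ++ rightTail n V (m + 1) := by
  rw [rightTail, rightTail, show n - m = n - (m + 1) + 1 by omega, List.range'_succ,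
    List.flatMap_cons, show n - (m + 1) + 1 = n - m by omega]

theorem leftTail_congr {V V' : ℕ → PosWord n} {m : ℕ} (h : ∀ i, m ≤ i → i < n → V i = V' i) :
    leftTail n V m = leftTail n V' m := by
  rw [leftTail, leftTail]
  congr 1
  refine List.flatMap_congr fun i hi => ?_
  rw [List.mem_range'_1] at hi
  rw [h i hi.1 (by omega)]

theorem monoidVal_leftTail {V : ℕ → PosWord n} {m : ℕ} (hm : m ≤ n)
    (hV : ∀ i, m ≤ i → i < n → InLetters 1 i (V i)) :
    monoidVal (leftTail n V m) = monoidVal (lambdaTail n m) * monoidVal (rightTail n V m) := by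
  induction hd : n - m generalizing m with
  | zero =>
    obtain rfl : n = m := by omega
    rw [leftTail_self, rightTail_self, lambdaTail_eq_append le_rfl, lambdaTail_of_lt (by omega)]
    simp
  | succ d ih =>
    rw [leftTail_of_lt V (by omega), rightTail_of_lt V (by omega), monoidVal_append,
      ih (by omega) (fun i h => hV i (by omega)) (by omega), lambdaTail_eq_append hm]
    have := word_mul_lambdaTail hm (hV m le_rfl (by omega))
    simp only [monoidVal_append, mul_assoc]
    rw [← mul_assoc (monoidVal (V m)), this, mul_assoc]

theorem gen_dvd_lambdaTail {x : Fin n} : gen x ∣ monoidVal (lambdaTail n (x.val + 1)) := by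
  rw [lambdaTail_eq_append (by omega), monoidVal_append]
  exact (gen_dvd_desc (by omega)).trans (dvd_mul_right _ _)

/-- As a_m divides Λ_m ⋯ Λ_n, no letter up to the first a_m exceeds it. The smaller ones form `V`
and do not affect divisibility; at a_m the whole of Λ_m is forced. -/
theorem Tame.exists_eq_append_lambdaWord {m : ℕ} (hm : 1 ≤ m) (hmn : m ≤ n) {A : PosWord n}
    (hA : Tame A) (h : monoidVal (lambdaTail n m) ∣ monoidVal A) :
    ∃ V B : PosWord n, InLetters 1 (m - 1) V ∧ A = V ++ lambdaWord n m ++ B ∧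
      monoidVal (lambdaTail n (m + 1)) ∣ monoidVal B := by
  obtain ⟨y, rfl⟩ : ∃ y : Fin n, m = y.val + 1 := ⟨⟨m - 1, by omega⟩, by simp only; omega⟩
  have hy := gen_dvd_lambdaTail.trans h
  induction A with
  | nil => exact (not_gen_dvd_one y hy).elim
  | cons z A ih =>
    have hzy : z ≤ y := hA.2.1 _ hy
    rcases hzy.eq_or_lt with rfl | hlt
    · have hl : lambdaTail n (z.val + 1) =
          lambdaWord n (z.val + 1) ++ lambdaTail n (z.val + 1 + 1) :=
        lambdaTail_eq_append hmn
      rw [hl, monoidVal_append] at h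
      obtain ⟨r, hr⟩ := hA.exists_eq_desc_append (j := 1) (by omega) ((dvd_mul_right _ _).trans h)
      refine ⟨[], r, inLetters_nil _ _, hr, ?_⟩
      rw [hr, monoidVal_append] at h
      obtain ⟨c, hc⟩ := h
      rw [mul_assoc] at hc
      exact ⟨c, mul_left_cancel hc⟩
    · rw [Fin.lt_def] at hlt
      have h' := lambdaTail_dvd_of_lt (by omega) h
      obtain ⟨V, B, h₁, rfl, h₂⟩ := ih hA.2.2 h' (gen_dvd_lambdaTail.trans h')
      exact ⟨z :: V, B, inLetters_cons.2 ⟨⟨by omega, by omega⟩, h₁⟩, rfl, h₂⟩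

theorem Tame.exists_eq_append_leftTail {m : ℕ} (hm : 1 ≤ m) (hmn : m ≤ n) {A : PosWord n}
    (hA : Tame A) (h : monoidVal (lambdaTail n m) ∣ monoidVal A) :
    ∃ (V : ℕ → PosWord n) (r : PosWord n), (∀ i, m - 1 ≤ i → i < n → InLetters 1 i (V i)) ∧
      A = V (m - 1) ++ leftTail n V m ++ r := by
  obtain ⟨U, B, hU, rfl, hB⟩ := hA.exists_eq_append_lambdaWord hm hmn h
  induction hd : n - m generalizing m U B with
  | zero =>
    obtain rfl : n = m := by omega
    refine ⟨fun _ => U, B, fun i h₁ _ => hU.mono le_rfl h₁, by rw [leftTail_self]⟩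
  | succ d ih =>
    obtain ⟨U', B', hU', rfl, hB'⟩ :=
      hA.of_append.exists_eq_append_lambdaWord (m := m + 1) (by omega) (by omega) hB
    obtain ⟨V, r, hV, e⟩ := ih (m := m + 1) (by omega) (by omega) U' B' hU' hB' hA.of_append hB
      (by omega)
    -- The word standing before Λ_m is the block of index `m - 1`.
    refine ⟨Function.update V (m - 1) U, r, fun i h₁ h₂ => ?_, ?_⟩
    · rcases eq_or_ne i (m - 1) with rfl | hne
      · rwa [Function.update_self]
      · rw [Function.update_of_ne hne]
        exact hV i (by omega) h₂
    · have hV' (i : ℕ) (hi : m ≤ i) : Function.update V (m - 1) U i = V i :=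
        Function.update_of_ne (by omega) _ _
      rw [Function.update_self, leftTail_of_lt _ (by omega), e, hV' m le_rfl,
        leftTail_congr (V' := V) (m := m + 1) fun i hi _ => hV' i (by omega)]
      simp

theorem Tame.exists_eq_leftDelta (hn : 1 ≤ n) {A : PosWord n} (hA : Tame A)
    (h : monoidVal (deltaWord n) ∣ monoidVal A) :
    ∃ (V : ℕ → PosWord n) (r : PosWord n), (∀ i, 1 ≤ i → i ≤ n - 1 → InLetters 1 i (V i)) ∧
      A = leftTail n V 1 ++ r := by
  obtain ⟨V, r, hV, rfl⟩ := hA.exists_eq_append_leftTail le_rfl hn h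
  refine ⟨V, r, fun i h₁ h₂ => hV i (by omega) (by omega), ?_⟩
  have h0 : V 0 = [] := by
    rw [List.eq_nil_iff_forall_not_mem]
    intro x hx
    have := hV 0 le_rfl hn x hx
    omega
  rw [Nat.sub_self, h0, List.nil_append]

/-! ### Conjugation by `Δ` -/

/-- The word `Λ_1 Λ_2 ⋯ Λ_m`. -/
def lambdaInit (n m : ℕ) : PosWord n := (List.range' 1 m).flatMap (lambdaWord n)

theorem lambdaInit_succ (m : ℕ) :
    lambdaInit n (m + 1) = lambdaInit n m ++ lambdaWord n (m + 1) := by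
  simp [lambdaInit, List.range'_1_concat, add_comm]

theorem inLetters_lambdaInit (m : ℕ) : InLetters 1 m (lambdaInit n m) := by
  intro x hx
  rw [lambdaInit, List.mem_flatMap] at hx
  obtain ⟨i, hi, hx⟩ := hx
  rw [List.mem_range'_1] at hi
  have := inLetters_desc i 1 x hx
  omega

theorem deltaWord_eq_append {m : ℕ} (h : m ≤ n) :
    deltaWord n = lambdaInit n m ++ lambdaTail n (m + 1) := by
  rw [deltaWord, lambdaInit, lambdaTail, ← List.flatMap_append]
  congr 1
  have := List.range'_append_1 (s := 1) (m := m) (n := n - m)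
  rw [show n + 1 - (m + 1) = n - m by omega, add_comm m 1, this]
  congr 1
  omega

/-- For a_{m+2}: it commutes with Λ_1 ⋯ Λ_m and a_{m+2} Λ_{m+1} = Λ_{m+2}. The claim becomes Λ_{m+2}
Λ_{m+2} = Λ_{m+1} Λ_{m+2} a_1, which follows from Λ_{m+1} Λ_{m+2} = Λ_{m+2} a_{m+2,2}. -/
theorem gen_mul_lambdaInit (x : Fin n) :
    gen x * monoidVal (lambdaInit n (x.val + 1)) =
      monoidVal (lambdaInit n (x.val + 1)) * gen ⟨0, x.pos⟩ := by
  let o : Fin n := ⟨0, x.pos⟩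
  have ho : desc n 1 1 = [o] := desc_self o
  obtain ⟨x, hx⟩ := x
  rcases x with _ | m
  · simp [lambdaInit, lambdaWord, ho, o]
  let y : Fin n := ⟨m + 1, hx⟩
  have h₁ : gen y * monoidVal (lambdaInit n m) = monoidVal (lambdaInit n m) * gen y :=
    gen_mul_of_far fun z hz => by
      have := inLetters_lambdaInit m z hz
      right
      change z.val + 2 ≤ m + 1
      omega
  have h₂ : monoidVal (lambdaWord n (m + 2)) = gen y * monoidVal (lambdaWord n (m + 1)) := by
    rw [← monoidVal_cons]
    exact congrArg monoidVal (desc_succ (x := y) (by omega))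
  have h₃ := word_mul_desc (n := n) (i := m + 1) hx (inLetters_desc (m + 1) 1)
  have h₄ : monoidVal (lambdaWord n (m + 2)) = monoidVal (desc n (m + 2) 2) * gen o := by
    rw [lambdaWord, desc_append (m := 1) (by omega) (by omega), ho, monoidVal_append]
    simp
  rw [shift_desc le_rfl hx] at h₃
  change gen y * monoidVal (lambdaInit n (m + 1 + 1)) =
    monoidVal (lambdaInit n (m + 1 + 1)) * gen o
  rw [lambdaInit_succ, lambdaInit_succ]
  simp only [monoidVal_append, mul_assoc]
  rw [← mul_assoc (gen y), h₁, mul_assoc, ← mul_assoc (gen y), ← h₂]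
  congr 1
  rw [← mul_assoc (monoidVal (lambdaWord n (m + 1)))]
  refine Eq.trans ?_ (congrArg (· * gen o) h₃.symm)
  rw [mul_assoc]
  exact congrArg _ h₄

/-- The element `Δ` of the braid monoid. -/
abbrev garsideElement (n : ℕ) : BraidMonoid n := monoidVal (deltaWord n)

/-- The letter a_m leaves Λ_1 ⋯ Λ_m as a_1, and the remaining n - m factors raise it to a_{n-m+1}.
-/
theorem gen_mul_garsideElement (x : Fin n) :
    gen x * garsideElement n = garsideElement n * gen x.rev := by
  have h := word_mul_lambdaTail (n := n) (m := x.val + 1) x.isLt (V := [⟨0, x.pos⟩])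
    (by rw [inLetters_cons]; exact ⟨⟨by simp, by simp⟩, inLetters_nil _ _⟩)
  have e : shift (n - (x.val + 1)) [(⟨0, x.pos⟩ : Fin n)] = [x.rev] := by
    rw [shift_cons, shift_nil]
    congr 1
    apply Fin.ext
    rw [Fin.val_rev]
    simp only [zero_add]
    exact Nat.mod_eq_of_lt (by omega)
  rw [e] at h
  simp only [monoidVal_cons, monoidVal_nil, mul_one] at h
  rw [garsideElement, deltaWord_eq_append x.isLt, monoidVal_append, ← mul_assoc,
    gen_mul_lambdaInit, mul_assoc, h, mul_assoc]

/-- Λ_m can be pulled to the front of Λ_1 ⋯ Λ_m, and it begins with a_m. -/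
theorem gen_dvd_garsideElement (x : Fin n) : gen x ∣ garsideElement n := by
  have h : monoidVal (lambdaInit n (x.val + 1)) = monoidVal (lambdaWord n (x.val + 1)) *
      monoidVal (shift 1 (lambdaInit n x.val)) := by
    rw [lambdaInit_succ, monoidVal_append]
    exact word_mul_desc x.isLt (inLetters_lambdaInit _)
  rw [garsideElement, deltaWord_eq_append x.isLt, monoidVal_append, h, mul_assoc]
  exact (gen_dvd_desc (by omega)).trans (dvd_mul_right _ _)

/-! ### The braid monoid embeds into the braid group -/

theorem garsideElement_sq_comm (m : BraidMonoid n) :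
    m * garsideElement n ^ 2 = garsideElement n ^ 2 * m := by
  obtain ⟨A, rfl⟩ := exists_monoidVal m
  induction A with
  | nil => simp
  | cons x A ih =>
    rw [monoidVal_cons, mul_assoc, ih, ← mul_assoc, ← mul_assoc, sq, ← mul_assoc,
      gen_mul_garsideElement, mul_assoc (garsideElement n), gen_mul_garsideElement, Fin.rev_rev,
      ← mul_assoc]

/-- The powers of the central element `Δ^2`. -/
abbrev centralPowers (n : ℕ) : Submonoid (BraidMonoid n) := Submonoid.powers (garsideElement n ^ 2)

theorem centralPowers_comm (s : centralPowers n) (m : BraidMonoid n) : s * m = m * s := by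
  obtain ⟨_, k, rfl⟩ := s
  exact (show Commute (garsideElement n ^ 2) m from (garsideElement_sq_comm m).symm).pow_left k

instance : OreLocalization.OreSet (centralPowers n) where
  ore_right_cancel r₁ r₂ s h := ⟨s, by rw [centralPowers_comm, centralPowers_comm, h]⟩
  oreNum r _ := r
  oreDenom _ s := s
  ore_eq r s := centralPowers_comm s r

/-- The group of fractions of the braid monoid. -/
abbrev Fractions (n : ℕ) : Type := OreLocalization (centralPowers n) (BraidMonoid n)

/-- The canonical homomorphism of the braid monoid to its fractions. -/
abbrev toFractions (n : ℕ) : BraidMonoid n →* Fractions n := OreLocalization.numeratorHom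

theorem toFractions_injective : Function.Injective (toFractions n) := by
  intro r₁ r₂ h
  rw [OreLocalization.numeratorHom_apply, OreLocalization.numeratorHom_apply,
    OreLocalization.oreDiv_eq_iff] at h
  obtain ⟨u, v, h₁, h₂⟩ := h
  simp only [OneMemClass.coe_one, mul_one] at h₂
  rw [← h₂] at h₁
  exact (mul_left_cancel h₁).symm

theorem isUnit_toFractions_gen (x : Fin n) : IsUnit (toFractions n (gen x)) := by
  have hu : IsUnit (toFractions n (garsideElement n ^ 2)) :=
    OreLocalization.numerator_isUnit ⟨garsideElement n ^ 2, Submonoid.mem_powers _⟩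
  obtain ⟨c, hc⟩ : gen x ∣ garsideElement n ^ 2 :=
    (gen_dvd_garsideElement x).trans (dvd_pow_self _ two_ne_zero)
  -- Centrality of Δ² turns the right cofactor of a_x into a left one.
  have hc' : c * gen x = garsideElement n ^ 2 := by
    apply gen_mul_cancel (x := x)
    rw [← mul_assoc, ← hc, garsideElement_sq_comm]
  obtain ⟨u, hu⟩ := hu
  refine isUnit_iff_exists_and_exists.2
    ⟨⟨toFractions n c * ↑u⁻¹, ?_⟩, ⟨↑u⁻¹ * toFractions n c, ?_⟩⟩
  · rw [← mul_assoc, ← map_mul, ← hc, ← hu, Units.mul_inv]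
  · rw [mul_assoc, ← map_mul, hc', ← hu, Units.inv_mul]

/-- The braid group maps to the units of the fractions of the braid monoid. -/
theorem exists_groupHom : ∃ f : BraidGroup n →* (Fractions n)ˣ,
    ∀ A : PosWord n, (f (groupVal A) : Fractions n) = toFractions n (monoidVal A) := by
  let g : Fin n → (Fractions n)ˣ := fun x => (isUnit_toFractions_gen x).unit
  have hg (w : FreeMonoid (Fin n)) :
      (FreeGroup.lift g (FreeMonoid.lift FreeGroup.of w) : Fractions n) =
      toFractions n (PresentedMonoid.mk _ w) := by
    induction w with
    | one => simp only [map_one, Units.val_one]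
    | of x => simp [g]; rfl
    | mul a b ha hb => simp only [map_mul, Units.val_mul, ha, hb]
  have h : ∀ r ∈ artinRelators n, FreeGroup.lift g r = 1 := by
    rintro _ ⟨u, v, huv, rfl⟩
    rw [map_mul, map_inv, mul_inv_eq_one]
    apply Units.ext
    rw [hg, hg, PresentedMonoid.mk_eq_mk_of_rel huv]
  refine ⟨PresentedGroup.toGroup h, fun A => ?_⟩
  induction A with
  | nil => exact (Units.ext_iff.1 (map_one _)).trans (map_one _).symm
  | cons x A ih =>
    have : groupVal (x :: A) = PresentedGroup.of x * groupVal A := by simp [groupVal]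
    rw [this, map_mul, Units.val_mul, ih, monoidVal_cons, map_mul, PresentedGroup.toGroup.of]
    rfl

theorem monoidVal_eq_of_groupVal_eq {A B : PosWord n} (h : groupVal A = groupVal B) :
    monoidVal A = monoidVal B := by
  obtain ⟨f, hf⟩ := exists_groupHom (n := n)
  apply toFractions_injective
  rw [← hf, ← hf, h]

/-- The canonical homomorphism of the braid monoid to the braid group. -/
def toBraidGroup (n : ℕ) : BraidMonoid n →* BraidGroup n :=
  PresentedMonoid.lift (PresentedGroup.of (rels := artinRelators n)) (by
    have h (w : FreeMonoid (Fin n)) :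
        FreeMonoid.lift (PresentedGroup.of (rels := artinRelators n)) w =
        PresentedGroup.mk (artinRelators n) (FreeMonoid.lift FreeGroup.of w) := by
      induction w with
      | one => simp
      | of x => rfl
      | mul a b ha hb => simp only [map_mul, ha, hb]
    intro u v huv
    rw [h, h, ← mul_inv_eq_one, ← map_inv, ← map_mul]
    exact PresentedGroup.one_of_mem ⟨u, v, huv, rfl⟩)

theorem toBraidGroup_monoidVal (A : PosWord n) : toBraidGroup n (monoidVal A) = groupVal A := by
  induction A with
  | nil => rfl
  | cons x A ih => rw [monoidVal_cons, map_mul, ih]; simp [groupVal, toBraidGroup]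

theorem groupVal_eq_iff {A B : PosWord n} : groupVal A = groupVal B ↔ monoidVal A = monoidVal B :=
  ⟨monoidVal_eq_of_groupVal_eq, fun h => by
    rw [← toBraidGroup_monoidVal, ← toBraidGroup_monoidVal, h]⟩

/-! ### The relations hold in the braid group -/

theorem wordVal_append (u v : Word n) : wordVal (u ++ v) = wordVal u * wordVal v := by
  simp [wordVal]

theorem wordVal_cons (x : Letter n) (u : Word n) : wordVal (x :: u) = letterVal x * wordVal u := by
  simp [wordVal]

theorem wordVal_nil : wordVal ([] : Word n) = 1 := rfl

theorem wordVal_pos (A : PosWord n) : wordVal (pos A) = groupVal A := by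
  simp [wordVal, pos, groupVal, Function.comp_def, letterVal]

theorem groupVal_append (A B : PosWord n) : groupVal (A ++ B) = groupVal A * groupVal B := by
  simp [groupVal]

theorem of_mul_groupVal_deltaWord (x : Fin n) :
    (PresentedGroup.of x : BraidGroup n) * groupVal (deltaWord n) =
      groupVal (deltaWord n) * PresentedGroup.of x.rev := by
  have h := congrArg (toBraidGroup n) (gen_mul_garsideElement x)
  rwa [map_mul, map_mul, toBraidGroup_monoidVal] at h

theorem S.wordVal_eq (hn : 1 ≤ n) {u v : Word n} (h : S n u v) : wordVal u = wordVal v := by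
  cases h with
  | braid i j V W hi hin hj hji hV hW hWi =>
    rw [leftBraid, rightBraid, wordVal_pos, wordVal_pos, groupVal_eq_iff]
    exact braid_relation hi hin hji hV hW
  | comm s k h =>
    change wordVal (pos [s, k]) = wordVal (pos [k, s])
    rw [wordVal_pos, wordVal_pos, groupVal_eq_iff]
    simpa using gen_far (.inr h)
  | garside V hV =>
    change wordVal (pos (leftTail n V 1)) = wordVal (_ :: pos (rightTail n V 1))
    rw [wordVal_cons, wordVal_pos, wordVal_pos, letterVal, ← groupVal_append, groupVal_eq_iff,
      monoidVal_append, monoidVal_leftTail hn fun i h₁ h₂ => hV i h₁ (by omega), lambdaTail_one]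
  | conj l =>
    simpa [wordVal, letterVal] using of_mul_groupVal_deltaWord l
  | conjInv l =>
    have h := of_mul_groupVal_deltaWord l.rev
    rw [Fin.rev_rev] at h
    simp only [wordVal_cons, wordVal_nil, letterVal, mul_one]
    rw [mul_inv_eq_iff_eq_mul, mul_assoc, h, inv_mul_cancel_left]
  | cancel => simp [wordVal, letterVal]
  | cancelInv => simp [wordVal, letterVal]

theorem Reduces.wordVal_eq (hn : 1 ≤ n) {u v : Word n} (h : Reduces u v) :
    wordVal v = wordVal u := by
  obtain ⟨p, u, v, q, h⟩ := h
  simp only [wordVal_append, h.wordVal_eq hn]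

theorem sIrreducible_iff {w : Word n} : SIrreducible w ↔ ¬ ∃ c, Reduces w c := by
  constructor
  · rintro h ⟨c, p, u, v, q, hS⟩
    exact h p u v q hS rfl
  · rintro h p u v q hS rfl
    exact h ⟨_, .intro p u v q hS⟩

/-! ### Termination -/

/-- The position of a letter in the order `Δ⁻¹ < Δ < a_1 < ⋯ < a_n`. -/
def Letter.rank : Letter n → ℕ
  | .deltaInv => 0
  | .delta => 1
  | .a x => x.val + 2

theorem length_rightTail_lt (V : ℕ → PosWord n) {m : ℕ} (hm : 1 ≤ m) (hmn : m ≤ n) :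
    (rightTail n V m).length < (leftTail n V m).length := by
  induction hd : n - m generalizing m with
  | zero =>
    obtain rfl : n = m := by omega
    rw [rightTail_self, leftTail_self, List.length_nil, List.length_pos_iff]
    exact List.ne_nil_of_mem (a := (⟨0, hm⟩ : Fin n)) (mem_desc.2 (by simp only; omega))
  | succ d ih =>
    have := ih (m := m + 1) (by omega) (by omega) (by omega)
    rw [rightTail_of_lt _ (by omega), leftTail_of_lt _ (by omega)]
    simp only [List.length_append, shift, List.length_map]
    omega

/-- Comparing first letters is enough: every length-preserving relation lowers the first letter. -/
theorem S.shorter_or_smaller (hn : 1 ≤ n) {u v : Word n} (h : S n u v) : v.length < u.length ∨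
    v.length = u.length ∧ ∃ x y u' v', u = x :: u' ∧ v = y :: v' ∧ y.rank < x.rank := by
  cases h with
  | braid i j V W hi hin hj hji hV hW hWi =>
    have hl := length_eq_of_monoidVal_eq (braid_relation hi hin hji hV hW)
    refine .inr ⟨?_, ?_⟩
    · rw [leftBraid, rightBraid, pos, pos, List.length_map, List.length_map, hl]
    · obtain ⟨i, rfl⟩ := Nat.exists_eq_add_of_le' hi
      have e₁ := desc_self (n := n) ⟨i, by omega⟩
      have e₂ := desc_succ (n := n) (x := ⟨i + 1, by omega⟩) (j := i + 1) (by simp)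
      simp only at e₁ e₂
      rw [leftBraid, rightBraid, e₁, e₂]
      exact ⟨_, _, _, _, rfl, rfl, by simp [Letter.rank]⟩
  | comm s k h =>
    exact .inr ⟨rfl, _, _, _, _, rfl, rfl, by simp only [Letter.rank]; omega⟩
  | garside V hV =>
    have hl := length_rightTail_lt V le_rfl hn
    change (_ :: pos (rightTail n V 1)).length < (pos (leftTail n V 1)).length ∨
      (_ :: pos (rightTail n V 1)).length = (pos (leftTail n V 1)).length ∧
      ∃ x y u' v', pos (leftTail n V 1) = _ ∧ _ :: pos (rightTail n V 1) = _ ∧ _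
    rw [pos, pos, List.length_cons, List.length_map, List.length_map]
    rcases Nat.lt_or_eq_of_le (Nat.succ_le_of_lt hl) with h | h
    · exact .inl h
    -- Lengths agree only for n = 1, where the relation is a_1 = Δ and Δ < a_1 decides.
    · refine .inr ⟨h, ?_⟩
      rcases hL : leftTail n V 1 with _ | ⟨x, L⟩
      · rw [hL] at hl
        exact (Nat.not_lt_zero _ hl).elim
      · exact ⟨_, _, _, _, rfl, rfl, by simp [Letter.rank]⟩
  | conj l => exact .inr ⟨rfl, _, _, _, _, rfl, rfl, by simp [Letter.rank]⟩
  | conjInv l => exact .inr ⟨rfl, _, _, _, _, rfl, rfl, by simp [Letter.rank]⟩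
  | cancel => exact .inl (by simp)
  | cancelInv => exact .inl (by simp)

theorem Reduces.shortlex (hn : 1 ≤ n) {u v : Word n} (h : Reduces u v) :
    List.Shortlex (InvImage (· < ·) Letter.rank) v u := by
  obtain ⟨p, u, v, q, h⟩ := h
  rcases h.shorter_or_smaller hn with h | ⟨hl, x, y, u', v', rfl, rfl, hr⟩
  · exact .of_length_lt (by simp only [List.length_append]; omega)
  · rw [List.append_assoc, List.append_assoc]
    have hlt : List.Shortlex (InvImage (· < ·) Letter.rank) (y :: v' ++ q) (x :: u' ++ q) :=
      .of_lex (by rw [List.length_append, List.length_append, hl]) (.rel hr)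
    exact hlt.append_left p

theorem acc_reduces (hn : 1 ≤ n) (w : Word n) : Acc (fun v u => Reduces u v) w :=
  Subrelation.accessible (fun h => Reduces.shortlex hn h)
    ((List.Shortlex.wf (InvImage.wf _ wellFounded_lt)).apply w)

/-! ### The shape of irreducible words -/

theorem SIrreducible.exists_eq {c : Word n} (h : SIrreducible c) :
    ∃ (k : ℤ) (A : PosWord n), c = deltaPow n k ++ pos A := by
  induction c with
  | nil => exact ⟨0, [], rfl⟩
  | cons x c ih =>
    obtain ⟨k, A, rfl⟩ := ih h.of_cons
    rcases x with _ | _ | x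
    · rcases k with (_ | k) | k
      · exact ⟨-1, A, rfl⟩
      · exact (h.not_S (u := []) (v := List.replicate k .delta ++ pos A) rfl .cancelInv).elim
      · exact ⟨.negSucc (k + 1), A, rfl⟩
    · rcases k with k | k
      · exact ⟨.ofNat (k + 1), A, rfl⟩
      · exact (h.not_S (u := []) (v := List.replicate k .deltaInv ++ pos A) rfl .cancel).elim
    · rcases k with (_ | k) | k
      · exact ⟨0, x :: A, rfl⟩
      · exact (h.not_S (u := []) (v := List.replicate k .delta ++ pos A) rfl (.conj x)).elim
      · exact (h.not_S (u := []) (v := List.replicate k .deltaInv ++ pos A) rfl (.conjInv x)).elim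

theorem wordVal_deltaPow (k : ℤ) : wordVal (deltaPow n k) = groupVal (deltaWord n) ^ k := by
  rcases k with k | k
  · simp [deltaPow, wordVal, letterVal]
  · simp [deltaPow, wordVal, letterVal, zpow_negSucc]

theorem SIrreducible.primeToDelta (hn : 1 ≤ n) {A : PosWord n} (h : SIrreducible (pos A)) :
    PrimeToDelta A := by
  intro A₁ e
  obtain ⟨V, r, hV, rfl⟩ := h.tame.exists_eq_leftDelta hn
    ⟨monoidVal A₁, by rw [e, monoidVal_append]⟩
  exact h.not_S (u := []) (v := pos r) (by rw [pos_append]; rfl) (S.garside V hV)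

/-! ### Uniqueness -/

/-- If k' > k, cancelling Δ^k exhibits `A` as Δ times a positive element in the group, hence in the
monoid. -/
theorem exponent_le {k k' : ℤ} {A A' : PosWord n} (hA : PrimeToDelta A)
    (h : groupVal (deltaWord n) ^ k * groupVal A = groupVal (deltaWord n) ^ k' * groupVal A') :
    k' ≤ k := by
  by_contra! hlt
  obtain ⟨d, rfl⟩ : ∃ d : ℕ, k' = k + (d + 1) := ⟨(k' - k - 1).toNat, by omega⟩
  rw [zpow_add, mul_assoc, mul_right_inj] at h
  obtain ⟨B, hB⟩ := exists_monoidVal (garsideElement n ^ d * monoidVal A')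
  refine hA B (monoidVal_eq_of_groupVal_eq ?_)
  rw [h, groupVal_append, ← toBraidGroup_monoidVal B, hB, map_mul, map_pow, toBraidGroup_monoidVal,
    toBraidGroup_monoidVal, ← mul_assoc, ← pow_succ']
  norm_cast

theorem deltaForm_unique {k k' : ℤ} {A A' : PosWord n} (hA : PrimeToDelta A)
    (hA' : PrimeToDelta A')
    (h : groupVal (deltaWord n) ^ k * groupVal A = groupVal (deltaWord n) ^ k' * groupVal A') :
    k = k' ∧ monoidVal A = monoidVal A' := by
  obtain rfl := le_antisymm (exponent_le hA' h.symm) (exponent_le hA h)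
  exact ⟨rfl, monoidVal_eq_of_groupVal_eq (mul_left_cancel h)⟩

/-! ### The explicit procedure -/

theorem posPart_pos (A : PosWord n) : posPart (pos A) = A := by
  induction A with
  | nil => rfl
  | cons x A ih => exact congrArg (x :: ·) ih

theorem length_lambdaWord {i : ℕ} (h : i ≤ n) : (lambdaWord n i).length = i := by
  induction i with
  | zero => rw [lambdaWord, desc_eq_nil (by omega), List.length_nil]
  | succ i ih =>
    have := desc_succ (n := n) (x := ⟨i, h⟩) (j := 1) (by simp)
    rw [lambdaWord, this, List.length_cons]
    exact congrArg (· + 1) (ih (by omega))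

theorem exists_leftTail_eq_cons (V : ℕ → PosWord n) {x : Fin n} :
    ∃ L, leftTail n V (x.val + 1) = x :: L := by
  have h : lambdaWord n (x.val + 1) = x :: desc n x.val 1 := desc_succ (by omega)
  rcases Nat.lt_or_eq_of_le (Nat.succ_le_of_lt x.isLt) with hlt | he
  · exact ⟨_, by rw [leftTail_of_lt V hlt, h]; rfl⟩
  · refine ⟨desc n x.val 1, ?_⟩
    rw [← h, leftTail, Nat.sub_eq_zero_of_le (by omega)]
    exact congrArg (lambdaWord n) he.symm

theorem drop_leftTail (V : ℕ → PosWord n) {m : ℕ} (h : m < n) :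
    (leftTail n V m).drop m = V m ++ leftTail n V (m + 1) := by
  rw [leftTail_of_lt V h, List.append_assoc, List.drop_left' (length_lambdaWord h.le)]

/-- Greedy reading is exact: V_i has letters up to a_i, and Λ_{i+1} after it begins with a_{i+1}. -/
theorem afterBlocks_leftTail {V : ℕ → PosWord n} (hV : ∀ i, 1 ≤ i → i ≤ n - 1 → InLetters 1 i (V i))
    {i : ℕ} (hi : i < n) : afterBlocks (leftTail n V 1) i = leftTail n V (i + 1) := by
  induction i with
  | zero => rfl
  | succ i ih =>
    obtain ⟨L, hL⟩ := exists_leftTail_eq_cons V (x := ⟨i + 1, hi⟩)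
    simp only at hL
    rw [afterBlocks, ih (by omega), drop_leftTail V hi, hL, List.dropWhile_append_of_pos,
      List.dropWhile_cons_of_neg]
    · simp
    · intro x hx
      have := hV (i + 1) (by omega) (by omega) x hx
      simpa using this.2

theorem block_leftTail {V : ℕ → PosWord n} (hV : ∀ i, 1 ≤ i → i ≤ n - 1 → InLetters 1 i (V i))
    {i : ℕ} (h₁ : 1 ≤ i) (hi : i < n) : block (leftTail n V 1) i = V i := by
  obtain ⟨L, hL⟩ := exists_leftTail_eq_cons V (x := ⟨i, hi⟩)
  simp only at hL
  rw [block, afterBlocks_leftTail hV (by omega), Nat.sub_add_cancel h₁, drop_leftTail V hi, hL,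
    List.takeWhile_append_of_pos, List.takeWhile_cons_of_neg, List.append_nil]
  · simp
  · intro x hx
    have := hV i (by omega) (by omega) x hx
    simpa using this.2

theorem inLetters_block (p : PosWord n) (i : ℕ) : InLetters 1 i (block p i) := by
  intro x hx
  have := List.mem_takeWhile_imp hx
  exact ⟨by omega, by simpa using this⟩

theorem S_of_mem_rightSides {u v : Word n} (h : v ∈ rightSides u) : S n u v := by
  simp only [rightSides, List.mem_append, List.mem_flatMap, List.mem_ite_nil_right,
    List.mem_singleton] at h
  rcases h with (((⟨i, hi, j, hj, b, -, c, -, ⟨hu, hV, hW, hWi⟩, rfl⟩ |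
    ⟨s, -, k, -, ⟨hsk, rfl⟩, rfl⟩) | ⟨hu, rfl⟩) | ⟨l, -, hl⟩) | ⟨hu, rfl⟩
  · rw [List.mem_range'_1] at hi hj
    have := S.braid i j _ _ hi.1 (by omega) hj.1 (by omega) hV hW hWi
    rwa [← hu] at this
  · exact .comm s k hsk
  · have := S.garside (block (posPart u)) fun i _ _ => inLetters_block _ i
    rwa [← hu] at this
  · split_ifs at hl with h₁ h₂
    · rw [List.mem_singleton.1 hl, h₁]
      exact .conj l
    · rw [List.mem_singleton.1 hl, h₂]
      exact .conjInv l
    · simp at hl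
  · rcases hu with rfl | rfl
    · exact .cancel
    · exact .cancelInv

/-- Some right-hand side is enough, not necessarily `v`: the procedure must only not stop at a
reducible word. -/
theorem exists_mem_rightSides (hn : 1 ≤ n) {u v : Word n} (h : S n u v) :
    ∃ v', v' ∈ rightSides u := by
  simp only [rightSides, List.mem_append, List.mem_flatMap, List.mem_ite_nil_right,
    List.mem_singleton]
  cases h with
  | braid i j V W hi hin hj hji hV hW hWi =>
    have hlen : (desc n (i + 1) i).length = 2 := by
      obtain ⟨i, rfl⟩ := Nat.exists_eq_add_of_le' hi
      have e₁ := desc_self (n := n) ⟨i, by omega⟩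
      have e₂ := desc_succ (n := n) (x := ⟨i + 1, by omega⟩) (j := i + 1) (by simp)
      simp only at e₁ e₂
      rw [e₂, e₁]
      rfl
    have hp : posPart (leftBraid n i j V W) = _ := posPart_pos _
    have eV : ((posPart (leftBraid n i j V W)).drop 2).take V.length = V := by
      rw [hp, List.append_assoc, List.append_assoc, List.drop_left' hlen, List.take_left]
    have eW : ((posPart (leftBraid n i j V W)).drop (2 + V.length)).take W.length = W := by
      rw [hp, List.append_assoc, List.drop_left' (by rw [List.length_append, hlen]), List.take_left]
    have hl : (leftBraid n i j V W).length =
        2 + V.length + W.length + (desc n (i + 1) j).length := by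
      simp [leftBraid, pos, hlen, add_assoc]
    refine ⟨_, .inl (.inl (.inl (.inl ⟨i, ?_, j, ?_, V.length, ?_, W.length, ?_, ?_, rfl⟩)))⟩
    · rw [List.mem_range'_1]; omega
    · rw [List.mem_range'_1]; omega
    · rw [List.mem_range]; omega
    · rw [List.mem_range]; omega
    · rw [eV, eW]
      exact ⟨rfl, hV, hW, hWi⟩
  | comm s k h =>
    exact ⟨_, .inl (.inl (.inl (.inr
      ⟨s, List.mem_finRange _, k, List.mem_finRange _, ⟨h, rfl⟩, rfl⟩)))⟩
  | garside V hV =>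
    refine ⟨_, .inl (.inl (.inr ⟨?_, rfl⟩))⟩
    change pos (leftTail n V 1) = pos (leftTail n (block (posPart (pos (leftTail n V 1)))) 1)
    rw [posPart_pos]
    exact congrArg pos (leftTail_congr fun i h₁ hi => (block_leftTail hV h₁ hi).symm)
  | conj l => exact ⟨[.delta, .a l.rev], .inl (.inr ⟨l, List.mem_finRange _, by simp⟩)⟩
  | conjInv l => exact ⟨[.deltaInv, .a l.rev], .inl (.inr ⟨l, List.mem_finRange _, by simp⟩)⟩
  | cancel => exact ⟨[], .inr ⟨.inl rfl, rfl⟩⟩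
  | cancelInv => exact ⟨[], .inr ⟨.inr rfl, rfl⟩⟩

theorem reduces_of_mem_reducts {w c : Word n} (h : c ∈ reducts w) : Reduces w c := by
  simp only [reducts, List.mem_flatMap, List.mem_map] at h
  obtain ⟨s, -, t, -, v, hv, rfl⟩ := h
  have := Reduces.intro (w.take s) _ _ ((w.drop s).drop t) (S_of_mem_rightSides hv)
  rwa [List.append_assoc, List.take_append_drop, List.take_append_drop] at this

theorem reducts_ne_nil (hn : 1 ≤ n) {w c : Word n} (h : Reduces w c) : reducts w ≠ [] := by
  obtain ⟨p, u, v, q, h⟩ := h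
  obtain ⟨v', hv'⟩ := exists_mem_rightSides hn h
  apply List.ne_nil_of_mem (a := p ++ v' ++ q)
  simp only [reducts, List.mem_flatMap, List.mem_map, List.mem_range]
  refine ⟨p.length, by simp only [List.length_append]; omega, u.length,
    by simp only [List.length_append]; omega, v', ?_, ?_⟩
  · rwa [List.append_assoc, List.drop_left, List.take_left]
  · rw [List.append_assoc p u q, List.drop_left, List.drop_left, List.take_left]

theorem reduces_step {w : Word n} (h : reducts w ≠ []) : Reduces w (step w) := by
  obtain ⟨c, l, hc⟩ := List.exists_cons_of_ne_nil h
  apply reduces_of_mem_reducts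
  rw [step, hc]
  simp

theorem step_of_sIrreducible {w : Word n} (h : SIrreducible w) : step w = w := by
  by_cases hw : reducts w = []
  · rw [step, hw]
    rfl
  · exact (sIrreducible_iff.1 h ⟨_, reduces_step hw⟩).elim

/-- Besides describing the procedure, this supplies the existence of irreducible words for a given
braid. -/
theorem exists_iterate_step (hn : 1 ≤ n) (w : Word n) : ∃ (c : Word n) (N : ℕ),
    wordVal c = wordVal w ∧ SIrreducible c ∧ ∀ m, N ≤ m → step^[m] w = c := by
  induction acc_reduces hn w with
  | intro w _ ih =>
    by_cases hw : SIrreducible w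
    · exact ⟨w, 0, rfl, hw, fun m _ => Function.iterate_fixed (step_of_sIrreducible hw) m⟩
    · rw [sIrreducible_iff, not_not] at hw
      obtain ⟨c, hc⟩ := hw
      have hs := reduces_step (reducts_ne_nil hn hc)
      obtain ⟨c, N, h₁, h₂, h₃⟩ := ih _ hs
      refine ⟨c, N + 1, h₁.trans (hs.wordVal_eq hn), h₂, fun m hm => ?_⟩
      obtain ⟨m, rfl⟩ := Nat.exists_eq_add_of_le' (Nat.le_of_add_left_le hm)
      rw [Function.iterate_succ_apply]
      exact h₃ m (by omega)

theorem exists_wordVal (g : BraidGroup n) : ∃ w : Word n, wordVal w = g := by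
  induction g using PresentedGroup.induction_on with
  | _ z =>
    induction z using FreeGroup.induction_on with
    | C1 => exact ⟨[], (map_one _).symm⟩
    | of x => exact ⟨[.a x], by simp [wordVal, letterVal]; rfl⟩
    | inv_of x _ =>
      -- From Δ = a_x C one gets a_x⁻¹ = C Δ⁻¹.
      obtain ⟨m, hm⟩ := gen_dvd_garsideElement x
      obtain ⟨C, rfl⟩ := exists_monoidVal m
      have h := congrArg (toBraidGroup n) hm
      rw [map_mul, toBraidGroup_monoidVal, toBraidGroup_monoidVal] at h
      refine ⟨pos C ++ [.deltaInv], ?_⟩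
      rw [wordVal_append, wordVal_pos, wordVal_cons, wordVal_nil, letterVal, mul_one, h,
        mul_inv_rev, mul_inv_cancel_left, map_inv]
      rfl
    | mul y z hy hz =>
      obtain ⟨u, hu⟩ := hy
      obtain ⟨v, hv⟩ := hz
      exact ⟨u ++ v, by rw [wordVal_append, hu, hv, map_mul]⟩

end ArtinGarside

/-! ### Proof of the corollary -/

open ArtinGarside in
theorem corollary3p1 (n : ℕ) (hn : 1 ≤ n) (g : ArtinGarside.BraidGroup n) :
    ∃ (k : ℤ) (A : ArtinGarside.PosWord n),
      -- the `S`-irreducible normal form of `g` exists, is unique, and is the word `Δ^k A`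
      (∀ c : ArtinGarside.Word n, ArtinGarside.IsSNormalForm g c ↔
        c = ArtinGarside.deltaPow n k ++ ArtinGarside.pos A) ∧
      -- `A` is not of the form `Δ A₁` in the braid group
      (∀ A₁ : ArtinGarside.PosWord n, ArtinGarside.groupVal A ≠
        ArtinGarside.groupVal (ArtinGarside.deltaWord n ++ A₁)) ∧
      -- the Garside normal form of `g` exists, is unique, and is `Δ^k A` as well
      (∀ (k' : ℤ) (A' : ArtinGarside.PosWord n), ArtinGarside.IsGarsideNormalForm g k' A' ↔
        k' = k ∧ A' = A) ∧
      -- algorithm: eliminating leading words in any order, starting from any word for `g`,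
      -- terminates, and it can only stop at the Garside normal form; the explicit procedure
      -- `step` finds it
      ∀ w : ArtinGarside.Word n, ArtinGarside.wordVal w = g →
        Acc (fun v u => ArtinGarside.Reduces u v) w ∧
        (∀ c : ArtinGarside.Word n, Relation.ReflTransGen ArtinGarside.Reduces w c →
          (¬ ∃ c' : ArtinGarside.Word n, ArtinGarside.Reduces c c') →
            c = ArtinGarside.deltaPow n k ++ ArtinGarside.pos A) ∧
        ∃ N : ℕ, ∀ m : ℕ, N ≤ m →
          ArtinGarside.step^[m] w = ArtinGarside.deltaPow n k ++ ArtinGarside.pos A := by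
  obtain ⟨w₀, hw₀⟩ := exists_wordVal g
  obtain ⟨c₀, -, hc₀, hirr, -⟩ := exists_iterate_step hn w₀
  rw [hw₀] at hc₀
  obtain ⟨k, A, rfl⟩ := hirr.exists_eq
  have hA : SIrreducible (pos A) := .of_append_append (w := []) (by simpa using hirr)
  have hval (k : ℤ) (A : PosWord n) :
      wordVal (deltaPow n k ++ pos A) = groupVal (deltaWord n) ^ k * groupVal A := by
    rw [wordVal_append, wordVal_deltaPow, wordVal_pos]
  rw [hval] at hc₀
  have hform : IsDeltaForm g k A := ⟨hc₀.symm, hA.primeToDelta hn⟩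
  have hunique {k' : ℤ} {A' : PosWord n} (h : IsDeltaForm g k' A') :
      k' = k ∧ monoidVal A = monoidVal A' := by
    obtain ⟨h₁, h₂⟩ := deltaForm_unique hform.2 h.2 (hform.1.symm.trans h.1)
    exact ⟨h₁.symm, h₂⟩
  have hnormal (c : Word n) : IsSNormalForm g c ↔ c = deltaPow n k ++ pos A := by
    constructor
    · rintro ⟨rfl, hc⟩
      obtain ⟨k', A', rfl⟩ := hc.exists_eq
      have hA' : SIrreducible (pos A') := .of_append_append (w := []) (by simpa using hc)
      obtain ⟨rfl, h⟩ := hunique ⟨hval k' A', hA'.primeToDelta hn⟩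
      rw [hA.tame.eq_of_monoidVal_eq hA'.tame h]
    · rintro rfl
      exact ⟨(hval k A).trans hc₀, hirr⟩
  refine ⟨k, A, hnormal, fun A₁ h => hform.2 A₁ (monoidVal_eq_of_groupVal_eq h), fun k' A' => ?_,
    fun w hw => ⟨acc_reduces hn w, fun c hc hfinal => ?_, ?_⟩⟩
  · constructor
    · rintro ⟨h, hmin⟩
      obtain ⟨rfl, e⟩ := hunique h
      refine ⟨rfl, ?_⟩
      -- Both `A'` (by hypothesis) and `A` (being tame) are least in the same class.
      rcases hmin k' A hform with h₁ | h₁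
      · exact h₁
      · rcases hA.tame.eq_or_shortlex e with h₂ | h₂
        · exact h₂.symm
        · exact (asymm h₁ h₂).elim
    · rintro ⟨rfl, rfl⟩
      exact ⟨hform, fun k'' A'' h => hA.tame.eq_or_shortlex (hunique h).2⟩
  · refine (hnormal c).1 ⟨?_, sIrreducible_iff.2 hfinal⟩
    rw [← hw]
    clear hfinal
    induction hc with
    | refl => rfl
    | tail _ h ih => rw [h.wordVal_eq hn, ih]
  · obtain ⟨c, N, h₁, h₂, h₃⟩ := exists_iterate_step hn w
    exact ⟨N, fun m hm => (h₃ m hm).trans ((hnormal c).1 ⟨h₁.trans hw, h₂⟩)⟩
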